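/- Let $\gamma_d(dx)=\pi^{-d/2}e^{-|x|^2}\,dx$ on $\mathbb{R}^d$. Let $p:\mathbb{R}^d\to[1,\infty)$ be measurable and suppose that - (class $\mathcal{P}^\infty_{\gamma_d}(\mathbb{R}^d)$) there are $C_{\gamma_d}>0$ and $p_\infty\ge 1$ with $|p(x)-p_\infty|\le C_{\gamma_d}/|x|^2$ for all $x\neq 0$; - (class $LH_0(\mathbb{R}^d)$) there is $C_1>0$ with $|p(x)-p(y)|\le \dfrac{C_1}{\log(e+1/|x-y|)}$ for all $x\ne y$. For measurable $f:\mathbb{R}^d\to\mathbb{R}$ put $\rho(f)=\int_{\mathbb{R}^d}|f(x)|^{p(x)}\,\gamma_d(dx)$ and $\|f\|_{p(\cdot),\gamma_d}=\inf\{\lambda>0:\rho(f/\lambda)\le 1\}$; $L^{p(\cdot)}(\gamma_d)$ consists of the measurable $f$ with $\rho(f/\lambda)<\infty$ for some $\lambda>0$. For $t>0$ define the Ornstein–Uhlenbeck semigroup $$T_tf(x)=\frac{1}{(1-e^{-2t})^{d/2}}\int_{\mathbb{R}^d}\exp\Big(-\frac{e^{-2t}(|x|^2+|y|^2)-2e^{-t}\langle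 x,y\rangle}{1-e^{-2t}}\Big)f(y)\,\gamma_d(dy)$$ and the Poisson–Hermite semigroup $$P_tf(x)=\frac1{\sqrt\pi}\int_0^\infty\frac{e^{-u}}{\sqrt u}\,T_{t^2/(4u)}f(x)\,du .$$ For every $f\in L^{p(\cdot)}(\gamma_d)$ and every $x\in\mathbb{R}^d$ these integrals converge absolutely and $t\mapsto P_tf(x)$ is $C^\infty$ on $(0,\infty)$; moreover $\frac{\partial^k}{\partial t^k}P_tf\in L^{p(\cdot)}(\gamma_d)$ for all integers $k\ge 0$ and all $t>0$. Furthermore: 1. There is a constant $C$, depending only on $d$ and $p(\cdot)$, such that for every integer $k\ge0$, every $f\in L^{p(\cdot)}(\gamma_d)$ and all $0<s<t<\infty$, $$\Big\|\frac{\partial^k}{\partial t^k}P_tf\Big\|_{p(\cdot),\gamma_d}\le C\,\Big\|\frac{\partial^k}{\partial s^k}P_sf\Big\|_{p(\cdot),\gamma_d}.$$ 2. For every integer $k\ge 0$ there is a constant $C_k$, depending only on $k$, $d$ and $p(\cdot)$, such that for every $f\in L^{p(\cdot)}(\gamma_d)$ and all $t>0$, $$\Big\|\frac{\partial^k}{\partial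 t^k}P_tf\Big\|_{p(\cdot),\gamma_d}\le \frac{C_k}{t^k}\,\|f\|_{p(\cdot),\gamma_d}.$$ -/

import Mathlib

open MeasureTheory Set
open scoped ENNReal NNReal ContDiff

noncomputable section

namespace VarGauss

/-- The Gaussian measure `γ_d(dx) = π^{-d/2} e^{-|x|²} dx` on `ℝ^d`. -/
def gaussMeasure (d : ℕ) : Measure (EuclideanSpace ℝ (Fin d)) :=
  volume.withDensity
    (fun x => ENNReal.ofReal (Real.exp (-‖x‖ ^ 2) / Real.pi ^ ((d : ℝ) / 2)))

/-- Local log-Hölder continuity of `p : ℝ^d → ℝ`. On the diagonal `x = y` the condition is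
trivial. -/
def LH0 {d : ℕ} (p : EuclideanSpace ℝ (Fin d) → ℝ) : Prop :=
  ∃ C : ℝ, 0 < C ∧ ∀ x y, |p x - p y| ≤ C / Real.log (Real.exp 1 + 1 / ‖x - y‖)

/-- The class `𝒫^∞_{γ_d}(ℝ^d)`: measurable exponents `p ≥ 1` with
`|p(x) - p_∞| ≤ C / |x|²` for all `x ≠ 0`, for some `p_∞ ≥ 1` and `C > 0`.
Exponents are real valued here: together with local log-Hölder continuity (which is a condition
on real-valued functions) the value `∞` cannot occur. -/
structure PGaussInf {d : ℕ} (p : EuclideanSpace ℝ (Fin d) → ℝ) : Prop where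
  aemeasurable : AEMeasurable p (gaussMeasure d)
  one_le : ∀ x, 1 ≤ p x
  decay : ∃ C pinf : ℝ, 0 < C ∧ 1 ≤ pinf ∧ ∀ x, x ≠ 0 → |p x - pinf| ≤ C / ‖x‖ ^ 2

/-- The modular `ρ_{p(·),γ_d}(f) = ∫ |f(x)|^{p(x)} γ_d(dx)` (finite-valued exponent, so there is
no `L^∞` term). -/
def modular {d : ℕ} (p f : EuclideanSpace ℝ (Fin d) → ℝ) : ℝ≥0∞ :=
  ∫⁻ x, ENNReal.ofReal (|f x| ^ p x) ∂(gaussMeasure d)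

/-- The Luxemburg norm `‖f‖_{p(·),γ_d} = inf {l > 0 : ρ(f / l) ≤ 1}`, equal to `∞` if there is no
such `l`. -/
def varNorm {d : ℕ} (p f : EuclideanSpace ℝ (Fin d) → ℝ) : ℝ≥0∞ :=
  ⨅ (l : ℝ) (_ : 0 < l ∧ modular p (fun x => f x / l) ≤ 1), ENNReal.ofReal l

/-- `f ∈ L^{p(·)}(γ_d)`. -/
def MemVarLp {d : ℕ} (p f : EuclideanSpace ℝ (Fin d) → ℝ) : Prop :=
  AEMeasurable f (gaussMeasure d) ∧ ∃ l : ℝ, 0 < l ∧ modular p (fun x => f x / l) < ⊤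

/-- The exponential factor of the Mehler kernel. -/
def mehlerExp {d : ℕ} (t : ℝ) (x y : EuclideanSpace ℝ (Fin d)) : ℝ :=
  Real.exp (-((Real.exp (-2 * t) * (‖x‖ ^ 2 + ‖y‖ ^ 2) - 2 * Real.exp (-t) * inner ℝ x y) /
    (1 - Real.exp (-2 * t))))

/-- The Ornstein-Uhlenbeck semigroup `T_t f(x)`, `t > 0`. -/
def ouSemigroup {d : ℕ} (t : ℝ) (f : EuclideanSpace ℝ (Fin d) → ℝ)
    (x : EuclideanSpace ℝ (Fin d)) : ℝ :=
  1 / (1 - Real.exp (-2 * t)) ^ ((d : ℝ) / 2) *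
    ∫ y, mehlerExp t x y * f y ∂(gaussMeasure d)

/-- The integrand of the Poisson-Hermite semigroup in the subordination variable `u`. -/
def phIntegrand {d : ℕ} (t : ℝ) (f : EuclideanSpace ℝ (Fin d) → ℝ)
    (x : EuclideanSpace ℝ (Fin d)) (u : ℝ) : ℝ :=
  Real.exp (-u) / Real.sqrt u * ouSemigroup (t ^ 2 / (4 * u)) f x

/-- The Poisson-Hermite semigroup `P_t f(x)`, `t > 0`. -/
def phSemigroup {d : ℕ} (t : ℝ) (f : EuclideanSpace ℝ (Fin d) → ℝ)
    (x : EuclideanSpace ℝ (Fin d)) : ℝ :=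
  1 / Real.sqrt Real.pi * ∫ u in Ioi (0 : ℝ), phIntegrand t f x u

/-- The function `x ↦ ∂^k/∂t^k P_t f(x)`. -/
def phDeriv {d : ℕ} (k : ℕ) (t : ℝ) (f : EuclideanSpace ℝ (Fin d) → ℝ)
    (x : EuclideanSpace ℝ (Fin d)) : ℝ :=
  iteratedDeriv k (fun τ => phSemigroup τ f x) t

end VarGauss

end

noncomputable section

namespace VarGauss

/-! ### The Mehler kernel as a symmetric Markov kernel for the Gaussian measure. -/

section Mehler

variable {d : ℕ}

/-! Both estimates rest on one fact: $g\mapsto P_t|g|$ is bounded on $L^{p(\cdot)}(\gamma_d)$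
uniformly in $t$ (`modular_le_one_of_enorm_le_phLint`). Monotonicity follows because
$\partial_t^kP_tf=P_{t-s}(\partial_s^kP_sf)$ (`phSemigroup_phDeriv`), so its constant does not
depend on $k$. Decay follows because the subordination density extends holomorphically in $t$, and
Cauchy's estimate on a disc of radius $t/4$ gives $|\partial_t^kP_tf|\le C_kt^{-k}P_{t/2}|f|$
pointwise (`enorm_phDeriv_le`).

The uniform bound comes from a Jensen inequality for variable exponents: if $\varphi\ge0$ and
$\rho(\varphi)\le1$, then $(T_s\varphi(x))^{p(x)}\le C(1+T_s(\varphi^{p(\cdot)})(x))$ for all $s$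
and $x$ (`ouLint_rpow_le`). Ordinary Jensen in the subordination variable carries it over to $P_t$.
Since $P_t$ preserves $\gamma_d$-integrals, integration bounds the modular of $P_t\varphi$ by a
constant, and $p\ge1$ turns that constant into a norm constant. No maximal function is needed.

Replacing $p(x)$ by another exponent costs a constant whenever the exponent gap times the logarithm
of the quantity is bounded (`rpow_le_exp_mul_rpow`). The Mehler kernel fits this by a dichotomy
(`mehlerKer_dichotomy`). For given $s,x$, either it is at most $e^{B(|x|^2+1)}$ and at most
$e^{B(|y|^2+1)}$, so the decay $|p-p_\infty|\lesssim|x|^{-2}$ suffices; or for some $l>0$ it is at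
most $e^{Nl}$ everywhere and bounded outside the ball of radius $e^{-l}$ about $x$, where local
log-Hölder continuity suffices. -/

lemma lintegral_exp_neg_mul_sq_norm_add_inner {b : ℝ} (hb : 0 < b)
    (w : EuclideanSpace ℝ (Fin d)) :
    ∫⁻ v : EuclideanSpace ℝ (Fin d), ENNReal.ofReal (Real.exp (-b * ‖v‖ ^ 2 + inner ℝ w v)) =
      ENNReal.ofReal ((Real.pi / b) ^ ((d : ℝ) / 2) * Real.exp (‖w‖ ^ 2 / (4 * b))) := by
  have key : ∀ v : EuclideanSpace ℝ (Fin d),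
      Real.exp (-b * ‖v‖ ^ 2 + inner ℝ w v) =
        Real.exp (-b * ‖v - (1 / (2 * b)) • w‖ ^ 2) * Real.exp (‖w‖ ^ 2 / (4 * b)) := by
    intro v
    rw [← Real.exp_add, @norm_sub_sq_real, norm_smul, inner_smul_right, real_inner_comm v w,
      Real.norm_of_nonneg (by positivity)]
    congr 1
    field
  have hint : ∫ v : EuclideanSpace ℝ (Fin d), Real.exp (-b * ‖v‖ ^ 2) =
      (Real.pi / b) ^ ((d : ℝ) / 2) := by
    have := GaussianFourier.integral_rexp_neg_mul_sq_norm (V := EuclideanSpace ℝ (Fin d)) hb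
    simpa using this
  have hpos : 0 < (Real.pi / b) ^ ((d : ℝ) / 2) := by positivity
  have hI : Integrable (fun v : EuclideanSpace ℝ (Fin d) => Real.exp (-b * ‖v‖ ^ 2)) := by
    by_contra h
    rw [integral_undef h] at hint
    exact hpos.ne hint
  simp_rw [key, ENNReal.ofReal_mul (Real.exp_nonneg _)]
  rw [lintegral_mul_const' _ _ ENNReal.ofReal_ne_top,
    lintegral_sub_right_eq_self
      (fun v : EuclideanSpace ℝ (Fin d) => ENNReal.ofReal (Real.exp (-b * ‖v‖ ^ 2))),
    ← ofReal_integral_eq_lintegral_ofReal hI (Filter.Eventually.of_forall fun _ =>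
      Real.exp_nonneg _), hint, ← ENNReal.ofReal_mul hpos.le]

lemma measurable_gaussDensity : Measurable (fun x : EuclideanSpace ℝ (Fin d) =>
    ENNReal.ofReal (Real.exp (-‖x‖ ^ 2) / Real.pi ^ ((d : ℝ) / 2))) := by
  fun_prop

lemma lintegral_gaussMeasure {F : EuclideanSpace ℝ (Fin d) → ℝ≥0∞} (hF : Measurable F) :
    ∫⁻ x, F x ∂(gaussMeasure d) =
      ∫⁻ x, ENNReal.ofReal (Real.exp (-‖x‖ ^ 2) / Real.pi ^ ((d : ℝ) / 2)) * F x := by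
  rw [gaussMeasure, lintegral_withDensity_eq_lintegral_mul _ measurable_gaussDensity hF]
  rfl

/-- Completing the square. The mass of $\gamma_d$, the mass of the Mehler kernel and the
Chapman–Kolmogorov identity are all instances, obtained by reading off `c`, `b`, `m` and `w`. -/
lemma lintegral_gauss_exp {c b m : ℝ} (hc : 0 ≤ c) (hb : 0 < 1 + b)
    (w : EuclideanSpace ℝ (Fin d)) :
    ∫⁻ v, ENNReal.ofReal (c * Real.exp (m - b * ‖v‖ ^ 2 + inner ℝ w v)) ∂(gaussMeasure d) =
      ENNReal.ofReal
        (c * (1 + b) ^ (-((d : ℝ) / 2)) * Real.exp (m + ‖w‖ ^ 2 / (4 * (1 + b)))) := by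
  rw [lintegral_gaussMeasure (by fun_prop)]
  have hpi : 0 < Real.pi ^ ((d : ℝ) / 2) := by positivity
  have key : ∀ v : EuclideanSpace ℝ (Fin d),
      ENNReal.ofReal (Real.exp (-‖v‖ ^ 2) / Real.pi ^ ((d : ℝ) / 2)) *
        ENNReal.ofReal (c * Real.exp (m - b * ‖v‖ ^ 2 + inner ℝ w v)) =
      ENNReal.ofReal (c * Real.exp m / Real.pi ^ ((d : ℝ) / 2)) *
        ENNReal.ofReal (Real.exp (-(1 + b) * ‖v‖ ^ 2 + inner ℝ w v)) := by
    intro v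
    rw [← ENNReal.ofReal_mul (by positivity), ← ENNReal.ofReal_mul (by positivity)]
    congr 1
    have : Real.exp (-‖v‖ ^ 2) * Real.exp (m - b * ‖v‖ ^ 2 + inner ℝ w v) =
        Real.exp m * Real.exp (-(1 + b) * ‖v‖ ^ 2 + inner ℝ w v) := by
      rw [← Real.exp_add, ← Real.exp_add]; congr 1; ring
    rw [div_mul_eq_mul_div, div_mul_eq_mul_div]
    congr 1
    linear_combination c * this
  simp_rw [key]
  rw [lintegral_const_mul' _ _ ENNReal.ofReal_ne_top, lintegral_exp_neg_mul_sq_norm_add_inner hb,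
    ← ENNReal.ofReal_mul (by positivity)]
  congr 1
  rw [Real.div_rpow Real.pi_pos.le hb.le, Real.rpow_neg hb.le, Real.exp_add]
  field_simp

instance : IsProbabilityMeasure (gaussMeasure d) := by
  constructor
  have := lintegral_gauss_exp (d := d) (c := 1) (b := 0) (m := 0) zero_le_one (by norm_num) 0
  simpa using this

/-- The kernel of the Ornstein-Uhlenbeck semigroup with respect to the Gaussian measure. -/
def mehlerKer (s : ℝ) (x y : EuclideanSpace ℝ (Fin d)) : ℝ :=
  1 / (1 - Real.exp (-2 * s)) ^ ((d : ℝ) / 2) * mehlerExp s x y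

lemma exp_neg_two_mul (s : ℝ) : Real.exp (-2 * s) = Real.exp (-s) ^ 2 := by
  rw [← Real.exp_nat_mul]; congr 1; push_cast; ring

lemma one_sub_exp_pos {s : ℝ} (hs : 0 < s) : 0 < 1 - Real.exp (-2 * s) := by
  have : Real.exp (-2 * s) < 1 := by rw [Real.exp_lt_one_iff]; linarith
  linarith

lemma mehlerKer_nonneg {s : ℝ} (hs : 0 < s) (x y : EuclideanSpace ℝ (Fin d)) :
    0 ≤ mehlerKer s x y := by
  have := one_sub_exp_pos hs
  unfold mehlerKer mehlerExp
  positivity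

lemma mehlerKer_comm (s : ℝ) (x y : EuclideanSpace ℝ (Fin d)) :
    mehlerKer s x y = mehlerKer s y x := by
  unfold mehlerKer mehlerExp
  rw [real_inner_comm, add_comm (‖x‖ ^ 2)]

@[fun_prop]
lemma measurable_mehlerKer {β : Type*} [MeasurableSpace β] {s : β → ℝ}
    {x y : β → EuclideanSpace ℝ (Fin d)} (hs : Measurable s) (hx : Measurable x)
    (hy : Measurable y) : Measurable fun b => mehlerKer (s b) (x b) (y b) := by
  unfold mehlerKer mehlerExp
  fun_prop

/-- The square is completed in $x$, which isolates the growth $e^{|x|^2}$; the remaining exponential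
is at most one. By symmetry the same form holds with $x$ and $y$ exchanged. -/
lemma mehlerKer_eq {s : ℝ} (hs : 0 < s) (x y : EuclideanSpace ℝ (Fin d)) :
    mehlerKer s x y = 1 / (1 - Real.exp (-2 * s)) ^ ((d : ℝ) / 2) *
      Real.exp (‖x‖ ^ 2 - ‖x - Real.exp (-s) • y‖ ^ 2 / (1 - Real.exp (-2 * s))) := by
  have h := one_sub_exp_pos hs
  unfold mehlerKer mehlerExp
  congr 2
  rw [@norm_sub_sq_real, norm_smul, inner_smul_right, Real.norm_of_nonneg (Real.exp_nonneg _)]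
  rw [exp_neg_two_mul] at h ⊢
  field_simp
  ring

lemma lintegral_mehlerKer {s : ℝ} (hs : 0 < s) (x : EuclideanSpace ℝ (Fin d)) :
    ∫⁻ y, ENNReal.ofReal (mehlerKer s x y) ∂(gaussMeasure d) = 1 := by
  have h := one_sub_exp_pos hs
  set T := 1 - Real.exp (-2 * s) with hT
  have hb : 1 + Real.exp (-s) ^ 2 / T = T⁻¹ := by
    rw [← exp_neg_two_mul]; refine eq_inv_of_mul_eq_one_left ?_; rw [add_mul, div_mul_cancel₀ _ h.ne']; linarith
  have := lintegral_gauss_exp (d := d) (c := 1 / T ^ ((d : ℝ) / 2)) (b := Real.exp (-s) ^ 2 / T)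
    (m := - (Real.exp (-s) ^ 2 / T * ‖x‖ ^ 2)) (by positivity) (by positivity)
    ((2 * Real.exp (-s) / T) • x)
  convert! this using 1
  · refine lintegral_congr fun y => ?_
    unfold mehlerKer mehlerExp
    rw [← hT, inner_smul_left, exp_neg_two_mul]
    congr 3
    simp only [conj_trivial]
    field
  · symm
    rw [hb, Real.inv_rpow h.le, Real.rpow_neg h.le, inv_inv, norm_smul,
      Real.norm_of_nonneg (by positivity)]
    have : -(Real.exp (-s) ^ 2 / T * ‖x‖ ^ 2) +
        (2 * Real.exp (-s) / T * ‖x‖) ^ 2 / (4 * T⁻¹) = 0 := by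
      field
    rw [this]
    have : T ^ ((d : ℝ) / 2) ≠ 0 := by positivity
    field_simp
    simp

/-- Chapman–Kolmogorov. With $a=e^{-s}$ and $b=e^{-r}$, addition of times is multiplication of $a$
and $b$, and the claim becomes rational algebra after one Gaussian integral. -/
lemma lintegral_mehlerKer_mul {s r : ℝ} (hs : 0 < s) (hr : 0 < r)
    (x y : EuclideanSpace ℝ (Fin d)) :
    ∫⁻ z, ENNReal.ofReal (mehlerKer s x z) * ENNReal.ofReal (mehlerKer r z y)
      ∂(gaussMeasure d) = ENNReal.ofReal (mehlerKer (s + r) x y) := by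
  have h1 := one_sub_exp_pos hs
  have h2 := one_sub_exp_pos hr
  have h3 := one_sub_exp_pos (add_pos hs hr)
  simp_rw [← ENNReal.ofReal_mul (mehlerKer_nonneg hs _ _)]
  unfold mehlerKer mehlerExp
  have e3 : Real.exp (-(s + r)) = Real.exp (-s) * Real.exp (-r) := by
    rw [← Real.exp_add]; congr 1; ring
  rw [exp_neg_two_mul] at h1 h2 h3
  simp_rw [exp_neg_two_mul]
  rw [e3] at h3 ⊢
  set a := Real.exp (-s)
  set b := Real.exp (-r)
  have hb : 1 + (a ^ 2 / (1 - a ^ 2) + b ^ 2 / (1 - b ^ 2)) =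
      (1 - (a * b) ^ 2) / ((1 - a ^ 2) * (1 - b ^ 2)) := by
    field
  have := lintegral_gauss_exp (d := d)
    (c := 1 / (1 - a ^ 2) ^ ((d : ℝ) / 2) * (1 / (1 - b ^ 2) ^ ((d : ℝ) / 2)))
    (b := a ^ 2 / (1 - a ^ 2) + b ^ 2 / (1 - b ^ 2))
    (m := - (a ^ 2 / (1 - a ^ 2) * ‖x‖ ^ 2 + b ^ 2 / (1 - b ^ 2) * ‖y‖ ^ 2))
    (by positivity) (by positivity)
    ((2 * a / (1 - a ^ 2)) • x + (2 * b / (1 - b ^ 2)) • y)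
  convert! this using 1
  · refine lintegral_congr fun z => ?_
    rw [mul_mul_mul_comm, ← Real.exp_add, inner_add_left, inner_smul_left, inner_smul_left,
      real_inner_comm z y]
    congr 3
    simp only [conj_trivial]
    field
  · rw [hb, Real.rpow_neg (by positivity), Real.div_rpow h3.le (by positivity),
      Real.mul_rpow h1.le h2.le, @norm_add_sq_real, norm_smul, norm_smul, inner_smul_left,
      inner_smul_right, Real.norm_of_nonneg (by positivity), Real.norm_of_nonneg (by positivity)]
    have hA : (1 - a ^ 2) ^ ((d : ℝ) / 2) ≠ 0 := by positivity
    have hB : (1 - b ^ 2) ^ ((d : ℝ) / 2) ≠ 0 := by positivity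
    have hC : (1 - (a * b) ^ 2) ^ ((d : ℝ) / 2) ≠ 0 := by positivity
    congr 2
    · field_simp
    · congr 1
      have h3' : 0 < 1 - a ^ 2 * b ^ 2 := by rwa [← mul_pow]
      simp only [conj_trivial]
      field

lemma mehlerKer_le {s : ℝ} (hs : 0 < s) (x y : EuclideanSpace ℝ (Fin d)) :
    mehlerKer s x y ≤ 1 / (1 - Real.exp (-2 * s)) ^ ((d : ℝ) / 2) * Real.exp (‖x‖ ^ 2) := by
  have h := one_sub_exp_pos hs
  rw [mehlerKer_eq hs]
  gcongr
  have : 0 ≤ ‖x - Real.exp (-s) • y‖ ^ 2 / (1 - Real.exp (-2 * s)) := by positivity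
  linarith

end Mehler

/-! ### Jensen inequalities with a variable exponent. -/

section Jensen

variable {α : Type*} [MeasurableSpace α] {μ : Measure α}

lemma rpow_lintegral_le (hμ : μ univ ≤ 1) {q : ℝ} (hq : 1 ≤ q) {φ : α → ℝ≥0∞}
    (hφ : AEMeasurable φ μ) : (∫⁻ x, φ x ∂μ) ^ q ≤ ∫⁻ x, φ x ^ q ∂μ := by
  have h := eLpNorm'_le_eLpNorm'_mul_rpow_measure_univ (μ := μ) one_pos hq
    hφ.aestronglyMeasurable
  have hq0 : 0 < q := by linarith
  have hle : μ univ ^ (1 / 1 - 1 / q) ≤ 1 := by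
    refine ENNReal.rpow_le_one hμ ?_
    rw [div_one, sub_nonneg, div_le_one hq0]
    exact hq
  have h2 : ∫⁻ x, φ x ∂μ ≤ (∫⁻ x, φ x ^ q ∂μ) ^ (1 / q) := by
    simpa [eLpNorm'] using h.trans (mul_le_of_le_one_right' hle)
  rwa [one_div, ENNReal.le_rpow_inv_iff hq0] at h2

/-- Jensen for the measure with density `k`; mass at most one suffices because $q\ge1$. -/
lemma rpow_lintegral_mul_le {k φ : α → ℝ≥0∞} (hk : Measurable k) (hk1 : ∫⁻ x, k x ∂μ ≤ 1)
    {q : ℝ} (hq : 1 ≤ q) (hφ : Measurable φ) :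
    (∫⁻ x, k x * φ x ∂μ) ^ q ≤ ∫⁻ x, k x * φ x ^ q ∂μ := by
  have h := rpow_lintegral_le (μ := μ.withDensity k) (by simpa using hk1) hq hφ.aemeasurable
  rwa [lintegral_withDensity_eq_lintegral_mul _ hk hφ,
    lintegral_withDensity_eq_lintegral_mul _ hk (hφ.pow_const q)] at h

/-- The only mechanism for changing exponents: for $1\le z\le e^L$, the factor $z^{u-v}$ is at most
$e^{(u-v)L}$ if $u\ge v$, and at most one otherwise. -/
lemma rpow_le_exp_mul_rpow {z : ℝ≥0∞} {L M u v : ℝ} (h1 : 1 ≤ z)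
    (hz : z ≤ ENNReal.ofReal (Real.exp L)) (hM : 0 ≤ M) (h : (u - v) * L ≤ M) :
    z ^ u ≤ ENNReal.ofReal (Real.exp M) * z ^ v := by
  have hz0 : z ≠ 0 := (zero_lt_one.trans_le h1).ne'
  have hzt : z ≠ ⊤ := (hz.trans_lt ENNReal.ofReal_lt_top).ne
  have : z ^ u = z ^ (u - v) * z ^ v := by rw [← ENNReal.rpow_add _ _ hz0 hzt]; simp
  rw [this]
  gcongr
  rcases le_total u v with huv | huv
  · calc z ^ (u - v) ≤ z ^ (0 : ℝ) := ENNReal.rpow_le_rpow_of_exponent_le h1 (by linarith)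
      _ ≤ _ := by simpa using hM
  · calc z ^ (u - v) ≤ ENNReal.ofReal (Real.exp L) ^ (u - v) :=
          ENNReal.rpow_le_rpow hz (by linarith)
      _ = ENNReal.ofReal (Real.exp (L * (u - v))) := by
          rw [ENNReal.ofReal_rpow_of_pos (Real.exp_pos _), ← Real.exp_mul]
      _ ≤ _ := by
          refine ENNReal.ofReal_le_ofReal (Real.exp_le_exp.2 ?_)
          linarith

lemma rpow_le_one_add_exp_mul_rpow {z : ℝ≥0∞} {L M u v : ℝ}
    (hz : z ≤ ENNReal.ofReal (Real.exp L)) (hM : 0 ≤ M) (h : (u - v) * L ≤ M) (hu : 0 ≤ u) :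
    z ^ u ≤ 1 + ENNReal.ofReal (Real.exp M) * z ^ v := by
  rcases le_total z 1 with h1 | h1
  · exact (ENNReal.rpow_le_one h1 hu).trans le_self_add
  · exact (rpow_le_exp_mul_rpow h1 hz hM h).trans le_add_self

lemma add_rpow_le_two_rpow_mul {a b : ℝ≥0∞} {q P : ℝ} (hq : 1 ≤ q) (hqP : q ≤ P) :
    (a + b) ^ q ≤ 2 ^ P * (a ^ q + b ^ q) := by
  refine (ENNReal.rpow_add_le_mul_rpow_add_rpow a b hq).trans ?_
  gcongr
  · norm_num
  · linarith

variable {p : α → ℝ} {k φ : α → ℝ≥0∞}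

lemma le_rpow_of_eq_zero_or_one_le {z : ℝ≥0∞} (hz : z = 0 ∨ 1 ≤ z) {u v : ℝ} (hu : 0 < u)
    (huv : u ≤ v) : z ^ u ≤ z ^ v := by
  rcases hz with rfl | h
  · rw [ENNReal.zero_rpow_of_pos hu]; exact zero_le
  · exact ENNReal.rpow_le_rpow_of_exponent_le h huv

lemma lintegral_le_one_of_modular_le (hp : ∀ y, 1 ≤ p y) (hφ : ∀ y, φ y = 0 ∨ 1 ≤ φ y)
    (h : ∫⁻ y, φ y ^ p y ∂μ ≤ 1) : ∫⁻ y, φ y ∂μ ≤ 1 :=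
  (lintegral_mono fun y => by
    simpa using le_rpow_of_eq_zero_or_one_le (hφ y) one_pos (hp y)).trans h

/-- The pointwise Jensen-type inequality when the exponent is close to its limit value. -/
lemma rpow_lintegral_mul_le_of_exp_bound (hp : ∀ y, 1 ≤ p y) {px pinf nx A B P : ℝ}
    {n : α → ℝ} (hn : Measurable n) (hpx : 1 ≤ px) (hpinf : 1 ≤ pinf) (hP : pinf ≤ P)
    (hnx : 0 ≤ nx) (hn0 : ∀ y, 0 ≤ n y) (hB : 0 ≤ B) (hAx : |px - pinf| * nx ≤ A)
    (hA : ∀ y, |p y - pinf| * n y ≤ A)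
    (hk : Measurable k) (hk1 : ∫⁻ y, k y ∂μ ≤ 1)
    (hkx : ∀ y, k y ≤ ENNReal.ofReal (Real.exp (B * nx)))
    (hky : ∀ y, k y ≤ ENNReal.ofReal (Real.exp (B * n y)))
    (hφm : Measurable φ) (hφ : ∀ y, φ y = 0 ∨ 1 ≤ φ y) (h : ∫⁻ y, φ y ^ p y ∂μ ≤ 1) :
    (∫⁻ y, k y * φ y ∂μ) ^ px ≤ 1 + ENNReal.ofReal (Real.exp (B * A)) * (2 ^ P *
      (2 * (ENNReal.ofReal (Real.exp (B * A)) * ∫⁻ y, k y * φ y ^ p y ∂μ))) := by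
  set D := ENNReal.ofReal (Real.exp (B * A)) with hD
  have hA0 : 0 ≤ A := (by positivity : 0 ≤ |px - pinf| * nx).trans hAx
  have hBA : 0 ≤ B * A := by positivity
  have hφ1 := lintegral_le_one_of_modular_le hp hφ h
  have hS : ∫⁻ y, k y * φ y ∂μ ≤ ENNReal.ofReal (Real.exp (B * nx)) :=
    calc ∫⁻ y, k y * φ y ∂μ ≤ ∫⁻ y, ENNReal.ofReal (Real.exp (B * nx)) * φ y ∂μ :=
          lintegral_mono fun y => by gcongr; exact hkx y
      _ ≤ _ := by
          rw [lintegral_const_mul' _ _ ENNReal.ofReal_ne_top]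
          exact mul_le_of_le_one_right' hφ1
  refine (rpow_le_one_add_exp_mul_rpow (v := pinf) hS hBA ?_
    (by linarith)).trans ?_
  · calc (px - pinf) * (B * nx) ≤ |px - pinf| * (B * nx) := by gcongr; exact le_abs_self _
      _ = B * (|px - pinf| * nx) := by ring
      _ ≤ B * A := by gcongr
  gcongr
  have hE : ∀ y, (1 : ℝ≥0∞) ≤ ENNReal.ofReal (Real.exp (B * n y)) := fun y => by
    have := hn0 y
    simpa using (by positivity : 0 ≤ B * n y)
  have hAy : ∀ y, (pinf - p y) * (B * n y) ≤ B * A := fun y => by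
    have := hn0 y
    calc (pinf - p y) * (B * n y) ≤ |p y - pinf| * (B * n y) := by
          gcongr
          rw [abs_sub_comm]
          exact le_abs_self _
      _ = B * (|p y - pinf| * n y) := by ring
      _ ≤ B * A := by gcongr; exact hA y
  -- Split `φ` at the height of the kernel bound. Below it, `φ` is small enough for the exponents
  -- `pinf` and `p y` to be exchanged; above it, `φ` dominates the kernel.
  set s : Set α := {y | φ y ≤ ENNReal.ofReal (Real.exp (B * n y))} with hs
  have hsm : MeasurableSet s := measurableSet_le hφm (by fun_prop)
  have hsplit : ∫⁻ y, k y * φ y ∂μ =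
      ∫⁻ y, k y * s.indicator φ y ∂μ + ∫⁻ y, sᶜ.indicator φ y * k y ∂μ := by
    rw [← lintegral_add_left (by measurability)]
    refine lintegral_congr fun y => ?_
    rw [mul_comm (sᶜ.indicator φ y), ← mul_add, Set.indicator_self_add_compl_apply]
  rw [hsplit]
  refine (add_rpow_le_two_rpow_mul hpinf hP).trans ?_
  rw [two_mul]
  gcongr
  · refine (rpow_lintegral_mul_le hk hk1 hpinf (hφm.indicator hsm)).trans ?_
    rw [← lintegral_const_mul' _ _ ENNReal.ofReal_ne_top]
    refine lintegral_mono fun y => ?_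
    rw [mul_left_comm]
    gcongr
    by_cases hy : y ∈ s
    · rw [Set.indicator_of_mem hy]
      rcases hφ y with h0 | h1
      · rw [h0, ENNReal.zero_rpow_of_pos (by linarith)]; exact zero_le
      · exact rpow_le_exp_mul_rpow h1 hy hBA (hAy y)
    · rw [Set.indicator_of_notMem hy, ENNReal.zero_rpow_of_pos (by linarith)]; exact zero_le
  -- Jensen with the roles exchanged: the large part of `φ` has mass at most one and serves as the
  -- weight, while the kernel is raised to the power `pinf`. The surplus `k y ^ (pinf - 1)` is then
  -- absorbed by `φ y ^ (p y - 1)`.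
  · refine (rpow_lintegral_mul_le (hφm.indicator hsm.compl) ?_ hpinf hk).trans ?_
    · exact (lintegral_mono fun y => Set.indicator_le_self _ _ _).trans hφ1
    rw [← lintegral_const_mul' _ _ ENNReal.ofReal_ne_top]
    refine lintegral_mono fun y => ?_
    by_cases hy : y ∈ s
    · rw [Set.indicator_of_notMem (by simpa using hy)]; simp
    · rw [Set.indicator_of_mem (by exact hy)]
      have hlt : ENNReal.ofReal (Real.exp (B * n y)) < φ y := not_le.1 hy
      have e1 : k y ^ pinf = k y ^ (pinf - 1) * k y := by
        conv_lhs => rw [show pinf = (pinf - 1) + 1 by ring]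
        rw [ENNReal.rpow_add_of_nonneg _ _ (by linarith) zero_le_one, ENNReal.rpow_one]
      have e2 : φ y ^ p y = φ y ^ (p y - 1) * φ y := by
        conv_lhs => rw [show p y = (p y - 1) + 1 by ring]
        rw [ENNReal.rpow_add_of_nonneg _ _ (by linarith [hp y]) zero_le_one, ENNReal.rpow_one]
      have e3 : k y ^ (pinf - 1) ≤ D * φ y ^ (p y - 1) := by
        calc k y ^ (pinf - 1) ≤ ENNReal.ofReal (Real.exp (B * n y)) ^ (pinf - 1) :=
              ENNReal.rpow_le_rpow (hky y) (by linarith)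
          _ ≤ D * ENNReal.ofReal (Real.exp (B * n y)) ^ (p y - 1) := by
              refine rpow_le_exp_mul_rpow (hE y) le_rfl hBA ?_
              convert! hAy y using 2
              ring
          _ ≤ _ := by
              gcongr
              linarith [hp y]
      rw [e1, e2]
      calc φ y * (k y ^ (pinf - 1) * k y) ≤ φ y * ((D * φ y ^ (p y - 1)) * k y) := by gcongr
        _ = _ := by ring

/-- The pointwise Jensen-type inequality when the kernel is concentrated on a set on which the
exponent varies little. -/
lemma rpow_lintegral_mul_le_of_concentrated (hp : ∀ y, 1 ≤ p y) {px δ L A P M : ℝ}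
    (hpx : 1 ≤ px) (hP : px ≤ P) (hL : 0 ≤ L) (hδ : 0 ≤ δ) (hδL : δ * L ≤ A) {s : Set α}
    (hsm : MeasurableSet s) (hs : ∀ y ∈ s, px - δ ≤ p y) (hM : 1 ≤ M)
    (hk : Measurable k) (hk1 : ∫⁻ y, k y ∂μ ≤ 1)
    (hkL : ∀ y, k y ≤ ENNReal.ofReal (Real.exp L))
    (hks : ∀ y ∉ s, k y ≤ ENNReal.ofReal M)
    (hφm : Measurable φ) (hφ : ∀ y, φ y = 0 ∨ 1 ≤ φ y) (h : ∫⁻ y, φ y ^ p y ∂μ ≤ 1) :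
    (∫⁻ y, k y * φ y ∂μ) ^ px ≤ 2 ^ P * ((1 + ENNReal.ofReal (Real.exp A) *
      ∫⁻ y, k y * φ y ^ p y ∂μ) + ENNReal.ofReal M ^ P) := by
  have hφ1 := lintegral_le_one_of_modular_le hp hφ h
  have hA0 : 0 ≤ A := (mul_nonneg hδ hL).trans hδL
  have hsplit : ∫⁻ y, k y * φ y ∂μ =
      ∫⁻ y, k y * s.indicator φ y ∂μ + ∫⁻ y, k y * sᶜ.indicator φ y ∂μ := by
    rw [← lintegral_add_left (by measurability)]
    refine lintegral_congr fun y => ?_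
    rw [← mul_add, Set.indicator_self_add_compl_apply]
  have hfar : ∫⁻ y, k y * sᶜ.indicator φ y ∂μ ≤ ENNReal.ofReal M :=
    calc ∫⁻ y, k y * sᶜ.indicator φ y ∂μ ≤ ∫⁻ y, ENNReal.ofReal M * φ y ∂μ := by
          refine lintegral_mono fun y => ?_
          by_cases hy : y ∈ s
          · rw [Set.indicator_of_notMem (by simpa using hy)]; simp
          · rw [Set.indicator_of_mem (by exact hy)]
            gcongr
            exact hks y hy
      _ ≤ _ := by
          rw [lintegral_const_mul' _ _ ENNReal.ofReal_ne_top]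
          exact mul_le_of_le_one_right' hφ1
  have hnear : ∫⁻ y, k y * s.indicator φ y ∂μ ≤ ENNReal.ofReal (Real.exp L) :=
    calc ∫⁻ y, k y * s.indicator φ y ∂μ ≤ ∫⁻ y, ENNReal.ofReal (Real.exp L) * φ y ∂μ := by
          refine lintegral_mono fun y => ?_
          gcongr
          · exact hkL y
          · exact Set.indicator_le_self _ _ _
      _ ≤ _ := by
          rw [lintegral_const_mul' _ _ ENNReal.ofReal_ne_top]
          exact mul_le_of_le_one_right' hφ1
  rw [hsplit]
  refine (add_rpow_le_two_rpow_mul hpx hP).trans ?_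
  gcongr
  -- The intermediate constant exponent lies below `p` on all of `s`, and the maximum with 1 keeps
  -- Jensen applicable.
  · refine (rpow_le_one_add_exp_mul_rpow (v := max 1 (px - δ)) hnear hA0 ?_
      (by linarith)).trans ?_
    · refine le_trans ?_ hδL
      gcongr
      linarith [le_max_right 1 (px - δ)]
    gcongr
    refine (rpow_lintegral_mul_le hk hk1 (le_max_left _ _) (hφm.indicator hsm)).trans ?_
    refine lintegral_mono fun y => ?_
    gcongr
    by_cases hy : y ∈ s
    · rw [Set.indicator_of_mem hy]
      exact le_rpow_of_eq_zero_or_one_le (hφ y) (by positivity) (max_le (hp y) (hs y hy))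
    · rw [Set.indicator_of_notMem hy, ENNReal.zero_rpow_of_pos (by positivity)]; exact zero_le
  · calc (∫⁻ y, k y * sᶜ.indicator φ y ∂μ) ^ px ≤ ENNReal.ofReal M ^ px :=
          ENNReal.rpow_le_rpow hfar (by linarith)
      _ ≤ _ := ENNReal.rpow_le_rpow_of_exponent_le (by simpa using hM) hP

end Jensen

/-! ### Two regimes of the Mehler kernel, and the pointwise inequality for $T_s$. -/

section Pointwise

variable {d : ℕ}

/-- Time is reparametrised by $e^{-2L}=1-e^{-2s}$ and $a=e^{-s}$, so that large $L$ means small $s$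
and the normalising factor becomes $e^{dL}$. -/
lemma exists_mehlerKer_eq_exp {s : ℝ} (hs : 0 < s) : ∃ L a : ℝ, 0 < L ∧ 0 < a ∧ a < 1 ∧
    a ^ 2 = 1 - Real.exp (-2 * L) ∧ ∀ x y : EuclideanSpace ℝ (Fin d),
      mehlerKer s x y = Real.exp (d * L + ‖x‖ ^ 2 - ‖x - a • y‖ ^ 2 * Real.exp (2 * L)) := by
  have h := one_sub_exp_pos hs
  have hlt : 1 - Real.exp (-2 * s) < 1 := by linarith [Real.exp_pos (-2 * s)]
  set T := 1 - Real.exp (-2 * s) with hT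
  have hexp : Real.exp (-2 * (-(Real.log T) / 2)) = T := by
    rw [show -2 * (-(Real.log T) / 2) = Real.log T by ring, Real.exp_log h]
  refine ⟨-(Real.log T) / 2, Real.exp (-s), by linarith [Real.log_neg h hlt], Real.exp_pos _, ?_,
    ?_, fun x y => ?_⟩
  · rw [Real.exp_lt_one_iff]; linarith
  · rw [hexp, ← exp_neg_two_mul, hT]; ring
  · rw [mehlerKer_eq hs, ← hT]
    have e1 : Real.exp (2 * (-(Real.log T) / 2)) = T⁻¹ := by
      rw [← hexp, ← Real.exp_neg, hexp]; congr 1; ring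
    have e2 : 1 / T ^ ((d : ℝ) / 2) = Real.exp (d * (-(Real.log T) / 2)) := by
      rw [Real.rpow_def_of_pos h, one_div, ← Real.exp_neg]; congr 1; ring
    rw [e1, e2, ← Real.exp_add]
    congr 1
    ring

-- In the notation of `exists_mehlerKer_eq_exp`, the first alternative is used when $L$ is bounded
-- or $|x|^2>4L$: the factor $e^{dL}$ is then paid for by $|x|^2$ and $|y|^2$, or killed by the
-- Gaussian term. Otherwise $x$ is so close to the origin that the kernel concentrates near $x$ at
-- scale $e^{-L/2}$.
set_option maxHeartbeats 1000000 in
lemma mehlerKer_dichotomy (d : ℕ) : ∃ B N M : ℝ, 0 ≤ B ∧ 0 ≤ N ∧ 1 ≤ M ∧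
    ∀ s : ℝ, 0 < s → ∀ x : EuclideanSpace ℝ (Fin d),
      ((∀ y, mehlerKer s x y ≤ Real.exp (B * (‖x‖ ^ 2 + 1))) ∧
        ∀ y, mehlerKer s x y ≤ Real.exp (B * (‖y‖ ^ 2 + 1))) ∨
      ∃ l : ℝ, 0 < l ∧ (∀ y, mehlerKer s x y ≤ Real.exp (N * l)) ∧
        ∀ y, Real.exp (-l) ≤ ‖x - y‖ → mehlerKer s x y ≤ M := by
  -- For $L>L_0$ this threshold gives $a\ge3/4$, $e^L\ge8$ and $e^{2L}\ge64(d+1)$.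
  set L₀ := Real.log (8 * (d + 1)) with hL₀
  have hd : (0 : ℝ) ≤ d := by positivity
  have hL₀0 : 0 ≤ L₀ := Real.log_nonneg (by linarith)
  refine ⟨d * L₀ + d + 1, 2 * d + 8, Real.exp (8 * (d + 4) ^ 2), by positivity, by positivity,
    Real.one_le_exp (by positivity), fun s hs x => ?_⟩
  obtain ⟨L, a, hL, ha0, ha1, haL, hK⟩ := exists_mehlerKer_eq_exp (d := d) hs
  have hK' : ∀ y, mehlerKer s x y =
      Real.exp (d * L + ‖y‖ ^ 2 - ‖y - a • x‖ ^ 2 * Real.exp (2 * L)) := fun y => by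
    rw [mehlerKer_comm, hK]
  have hdL₀ : 0 ≤ d * L₀ := by positivity
  have hx0 : 0 ≤ ‖x‖ ^ 2 := by positivity
  have hpos : ∀ z : EuclideanSpace ℝ (Fin d), 0 ≤ ‖z‖ ^ 2 * Real.exp (2 * L) := fun z => by
    positivity
  have hexpB : ∀ X : ℝ, 0 ≤ X → d * L₀ + (d + 1) * X ≤ (d * L₀ + d + 1) * (X + 1) :=
    fun X hX => by nlinarith [mul_nonneg hdL₀ hX]
  rcases le_or_gt L L₀ with hLL | hLL
  · left
    have hdL : d * L ≤ d * L₀ := by gcongr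
    refine ⟨fun y => ?_, fun y => ?_⟩
    · rw [hK]
      refine Real.exp_le_exp.2 ?_
      linarith [hpos (x - a • y), hexpB _ hx0, mul_nonneg hd hx0]
    · rw [hK']
      refine Real.exp_le_exp.2 ?_
      linarith [hpos (y - a • x), hexpB _ (sq_nonneg ‖y‖), mul_nonneg hd (sq_nonneg ‖y‖)]
  · have hexpL : 8 * (d + 1) ≤ Real.exp L := by
      rw [← Real.log_le_iff_le_exp (by positivity)]; exact hLL.le
    have hexp2 : Real.exp (2 * L) = Real.exp L ^ 2 := by
      rw [← Real.exp_nat_mul]; congr 1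
    have hinv : Real.exp (-2 * L) * Real.exp L ^ 2 = 1 := by
      rw [← hexp2, ← Real.exp_add]; simp
    have ha34 : 3 / 4 ≤ a := by
      have h1 : Real.exp (-2 * L) ≤ 1 / 64 := by
        have h64 : 64 ≤ Real.exp L ^ 2 := by nlinarith
        nlinarith [mul_le_mul_of_nonneg_left h64 (Real.exp_pos (-2 * L)).le]
      nlinarith
    rcases le_or_gt (‖x‖ ^ 2) (4 * L) with hxL | hxL
    · right
      -- Here $dL+|x|^2\le(d+4)L=(2d+8)\cdot L/2$, which is where `N` comes from.
      refine ⟨L / 2, by positivity, fun y => ?_, fun y hy => ?_⟩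
      · rw [hK]
        refine Real.exp_le_exp.2 ?_
        linarith [hpos (x - a • y)]
      · rw [hK]
        refine Real.exp_le_exp.2 ?_
        set ρ := Real.exp (L / 2) with hρ
        have hρL : ρ ^ 2 = Real.exp L := by
          rw [hρ, ← Real.exp_nat_mul]; congr 1; push_cast; ring
        have hρ0 : 0 < ρ := Real.exp_pos _
        have hyρ : 1 ≤ ρ * ‖x - y‖ := by
          rw [Real.exp_neg] at hy
          rwa [inv_le_iff_one_le_mul₀' hρ0] at hy
        have hxρ : ‖x‖ ≤ 2 * ρ := by
          refine abs_le_of_sq_le_sq' ?_ (by positivity) |>.2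
          nlinarith [Real.add_one_le_exp L]
        -- Since $1-a\le1-a^2=e^{-2L}$, replacing $x-y$ by $x-ay$ is harmless at scale $e^{-L/2}$.
        have h1a : (1 - a) * ρ ^ 4 ≤ 1 := by
          have : ρ ^ 4 = Real.exp L ^ 2 := by rw [← hρL]; ring
          rw [this, ← hinv]
          gcongr
          nlinarith
        have hnorm : a * ‖x - y‖ - (1 - a) * ‖x‖ ≤ ‖x - a • y‖ := by
          have : x - a • y = a • (x - y) - (-(1 - a)) • x := by module
          rw [this]
          refine le_trans ?_ (norm_sub_norm_le _ _)
          rw [norm_smul, norm_smul, norm_neg, Real.norm_of_nonneg ha0.le,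
            Real.norm_of_nonneg (by linarith)]
        have hρ8 : 8 ≤ ρ ^ 2 := by rw [hρL]; linarith
        have hbig : 1 / 4 ≤ ρ * ‖x - a • y‖ := by
          have h2 : (1 - a) * (ρ * ‖x‖) ≤ 1 / 4 := by
            have h3 : (1 - a) * (ρ * ‖x‖) ≤ (1 - a) * (ρ * (2 * ρ)) := by
              have : 0 ≤ 1 - a := by linarith
              gcongr
            have h4 : (1 - a) * ρ ^ 2 * 8 ≤ (1 - a) * ρ ^ 2 * ρ ^ 2 := by
              have : 0 ≤ 1 - a := by linarith
              gcongr
            nlinarith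
          nlinarith [mul_le_mul_of_nonneg_left hnorm hρ0.le]
        have hsq : Real.exp L / 16 ≤ ‖x - a • y‖ ^ 2 * Real.exp (2 * L) := by
          rw [hexp2, ← hρL]
          have : (1 / 4) ^ 2 ≤ (ρ * ‖x - a • y‖) ^ 2 := by gcongr
          nlinarith [mul_le_mul_of_nonneg_left this (sq_nonneg ρ)]
        -- As $e^L\ge L^2/2$, the exponent is at most $(d+4)L-L^2/32$, whose maximum $8(d+4)^2$ is
        -- attained at $L=16(d+4)$; this fixes `M`.
        nlinarith [Real.quadratic_le_exp_of_nonneg hL.le, sq_nonneg (L - 16 * (d + 4))]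
    · left
      refine ⟨fun y => ?_, fun y => ?_⟩
      · rw [hK]
        refine Real.exp_le_exp.2 ?_
        have : d * L ≤ d * ‖x‖ ^ 2 := by gcongr; linarith
        linarith [hpos (x - a • y), hexpB _ hx0]
      · rw [hK']
        refine Real.exp_le_exp.2 ?_
        rcases le_or_gt L (‖y‖ ^ 2) with hyL | hyL
        · have : d * L ≤ d * ‖y‖ ^ 2 := by gcongr
          linarith [hpos (y - a • x), hexpB _ (sq_nonneg ‖y‖)]
        -- Now $|y|<\sqrt L$ and $|x|\ge2\sqrt L$ are far apart, and the Gaussian term gains at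
        -- least $16(d+1)L$, more than $dL$.
        · have hsL : Real.sqrt L ^ 2 = L := Real.sq_sqrt hL.le
          have hsL0 : 0 ≤ Real.sqrt L := Real.sqrt_nonneg _
          have hy' : ‖y‖ ≤ Real.sqrt L := Real.le_sqrt_of_sq_le hyL.le
          have hx' : 2 * Real.sqrt L ≤ ‖x‖ := by
            refine abs_le_of_sq_le_sq' ?_ (by positivity) |>.2
            nlinarith
          have hnorm : a * ‖x‖ - ‖y‖ ≤ ‖y - a • x‖ := by
            rw [norm_sub_rev]
            refine le_trans ?_ (norm_sub_norm_le _ _)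
            rw [norm_smul, Real.norm_of_nonneg ha0.le]
          have hlow : Real.sqrt L / 2 ≤ ‖y - a • x‖ := by nlinarith
          have hlow2 : L / 4 ≤ ‖y - a • x‖ ^ 2 := by
            have : (Real.sqrt L / 2) ^ 2 ≤ ‖y - a • x‖ ^ 2 := by gcongr
            nlinarith
          have h64 : 64 * (d + 1) ≤ Real.exp (2 * L) := by rw [hexp2]; nlinarith
          have : L / 4 * (64 * (d + 1)) ≤ ‖y - a • x‖ ^ 2 * Real.exp (2 * L) := by gcongr
          have h0 : 0 ≤ (d * L₀ + d + 1) * (‖y‖ ^ 2 + 1) := by positivity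
          linarith [mul_nonneg hd hL.le]

lemma LH0.exists_le {p : EuclideanSpace ℝ (Fin d) → ℝ} (h : LH0 p) : ∃ P : ℝ, ∀ x, p x ≤ P := by
  obtain ⟨C, hC, h⟩ := h
  refine ⟨p 0 + C, fun x => ?_⟩
  have h1 : 1 ≤ Real.log (Real.exp 1 + 1 / ‖x - 0‖) := by
    rw [Real.le_log_iff_exp_le (by positivity)]
    have : 0 ≤ 1 / ‖x - 0‖ := by positivity
    linarith
  have h2 : C / Real.log (Real.exp 1 + 1 / ‖x - 0‖) ≤ C := div_le_self hC.le h1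
  linarith [le_abs_self (p x - p 0), h x 0]

/-- The Ornstein-Uhlenbeck semigroup on `[0, ∞]`-valued functions. -/
def ouLint (s : ℝ) (φ : EuclideanSpace ℝ (Fin d) → ℝ≥0∞) (x : EuclideanSpace ℝ (Fin d)) :
    ℝ≥0∞ :=
  ∫⁻ y, ENNReal.ofReal (mehlerKer s x y) * φ y ∂(gaussMeasure d)

lemma measurable_mehlerKer_right (s : ℝ) (x : EuclideanSpace ℝ (Fin d)) :
    Measurable (fun y => ENNReal.ofReal (mehlerKer s x y)) := by
  fun_prop

/-- Each alternative of the dichotomy is matched with its Jensen inequality: decay of $p$ at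
infinity in the first, log-Hölder continuity in the second. -/
lemma ouLint_rpow_le_of_eq_zero_or_one_le {p : EuclideanSpace ℝ (Fin d) → ℝ} (hp : PGaussInf p)
    (hLH : LH0 p) : ∃ C : ℝ≥0, ∀ s : ℝ, 0 < s → ∀ φ : EuclideanSpace ℝ (Fin d) → ℝ≥0∞,
      Measurable φ → (∀ y, φ y = 0 ∨ 1 ≤ φ y) → ∫⁻ y, φ y ^ p y ∂(gaussMeasure d) ≤ 1 →
      ∀ x, ouLint s φ x ^ p x ≤ C * (1 + ouLint s (fun y => φ y ^ p y) x) := by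
  obtain ⟨P, hP⟩ := hLH.exists_le
  obtain ⟨C₁, hC₁, hC₁p⟩ := hLH
  obtain ⟨A₀, pinf, hA₀, hpinf, hdec⟩ := hp.decay
  obtain ⟨B, N, M, hB, hN, hM, hdich⟩ := mehlerKer_dichotomy d
  set Q := max P pinf with hQ
  have hQ1 : 1 ≤ Q := hpinf.trans (le_max_right _ _)
  set A := A₀ + Q with hA
  have hdec' : ∀ x, |p x - pinf| * (‖x‖ ^ 2 + 1) ≤ A := by
    intro x
    have h1 : |p x - pinf| ≤ Q := by
      rw [abs_le]
      constructor
      · linarith [hp.one_le x, le_max_right P pinf]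
      · linarith [hP x, le_max_left P pinf]
    have h2 : |p x - pinf| * ‖x‖ ^ 2 ≤ A₀ := by
      by_cases hx : x = 0
      · simp [hx, hA₀.le]
      · have : 0 < ‖x‖ ^ 2 := by positivity
        exact (le_div_iff₀ this).1 (hdec x hx)
    linarith
  set E₁ : ℝ≥0 := (Real.exp (B * A)).toNNReal
  set E₂ : ℝ≥0 := (Real.exp (N * C₁)).toNNReal
  refine ⟨(1 + E₁ * (2 ^ Q * (2 * E₁))) + 2 ^ Q * (1 + E₂ + M.toNNReal ^ Q), ?_⟩
  intro s hs φ hφm hφ hmod x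
  have hcoe : ((((1 + E₁ * (2 ^ Q * (2 * E₁))) + 2 ^ Q * (1 + E₂ + M.toNNReal ^ Q) : ℝ≥0)) :
      ℝ≥0∞) = (1 + E₁ * (2 ^ Q * (2 * E₁))) + 2 ^ Q * (1 + E₂ + (M.toNNReal : ℝ≥0∞) ^ Q) := by
    push_cast [ENNReal.coe_rpow_of_nonneg _ (by linarith : 0 ≤ Q)]
    rfl
  rw [hcoe]
  have hk1 : ∫⁻ y, ENNReal.ofReal (mehlerKer s x y) ∂(gaussMeasure d) ≤ 1 :=
    (lintegral_mehlerKer hs x).le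
  rcases hdich s hs x with ⟨h1, h2⟩ | ⟨l, hl, h1, h2⟩
  · have := rpow_lintegral_mul_le_of_exp_bound (P := Q) hp.one_le (n := fun y => ‖y‖ ^ 2 + 1)
      (by fun_prop) (hp.one_le x) hpinf (le_max_right _ _) (by positivity) (fun y => by positivity)
      hB (hdec' x) hdec' (measurable_mehlerKer_right s x) hk1
      (fun y => ENNReal.ofReal_le_ofReal (h1 y)) (fun y => ENNReal.ofReal_le_ofReal (h2 y))
      hφm hφ hmod
    refine this.trans ?_
    change 1 + (E₁ : ℝ≥0∞) * (2 ^ Q * (2 * (E₁ * ouLint s (fun y => φ y ^ p y) x))) ≤ _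
    set X := ouLint s (fun y => φ y ^ p y) x
    calc 1 + (E₁ : ℝ≥0∞) * (2 ^ Q * (2 * (E₁ * X)))
        ≤ (1 + E₁ * (2 ^ Q * (2 * E₁))) * (1 + X) := by
          rw [add_mul, one_mul]
          refine add_le_add le_self_add ?_
          calc (E₁ : ℝ≥0∞) * (2 ^ Q * (2 * (E₁ * X))) = E₁ * (2 ^ Q * (2 * E₁)) * X := by ring
            _ ≤ _ := by gcongr; exact le_add_self
      _ ≤ _ := mul_le_mul_left le_self_add _
  -- On the ball of radius $e^{-l}$ the exponent varies by at most $C_1/l$; multiplied by the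
  -- logarithmic kernel bound $Nl$, this is $NC_1$, independent of $l$.
  · have := rpow_lintegral_mul_le_of_concentrated (P := Q) (L := N * l) (δ := C₁ / l)
      (A := N * C₁) (s := {y | ‖x - y‖ < Real.exp (-l)}) hp.one_le (hp.one_le x)
      ((hP x).trans (le_max_left _ _)) (by positivity) (by positivity)
      (le_of_eq (by field_simp)) (measurableSet_lt (by fun_prop) (by fun_prop))
      (fun y hy => ?_) hM (measurable_mehlerKer_right s x) hk1
      (fun y => ENNReal.ofReal_le_ofReal (h1 y))
      (fun y hy => ENNReal.ofReal_le_ofReal (h2 y (not_lt.1 hy))) hφm hφ hmod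
    · refine this.trans ?_
      change 2 ^ Q * (1 + E₂ * ouLint s (fun y => φ y ^ p y) x + (M.toNNReal : ℝ≥0∞) ^ Q) ≤ _
      set X := ouLint s (fun y => φ y ^ p y) x
      calc 2 ^ Q * (1 + E₂ * X + (M.toNNReal : ℝ≥0∞) ^ Q)
          ≤ 2 ^ Q * ((1 + E₂ + (M.toNNReal : ℝ≥0∞) ^ Q) * (1 + X)) := by
            gcongr
            rw [add_mul, add_mul]
            gcongr
            · simp
            · exact le_add_self
            · exact le_mul_of_one_le_right' le_self_add
        _ ≤ _ := by
            rw [← mul_assoc]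
            gcongr
            exact le_add_self
    · by_cases hxy : x = y
      · subst hxy
        have : 0 < C₁ / l := by positivity
        linarith
      · have hpos : 0 < ‖x - y‖ := norm_pos_iff.2 (sub_ne_zero.2 hxy)
        have hlog : l ≤ Real.log (Real.exp 1 + 1 / ‖x - y‖) := by
          rw [Real.le_log_iff_exp_le (by positivity)]
          have hlt : ‖x - y‖ < Real.exp (-l) := hy
          have : Real.exp l ≤ 1 / ‖x - y‖ := by
            rw [le_div_iff₀ hpos]
            calc Real.exp l * ‖x - y‖ ≤ Real.exp l * Real.exp (-l) := by gcongr
              _ = 1 := by rw [← Real.exp_add]; simp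
          linarith [Real.exp_pos 1]
        have h3 : C₁ / Real.log (Real.exp 1 + 1 / ‖x - y‖) ≤ C₁ / l := by gcongr
        linarith [le_abs_self (p x - p y), hC₁p x y]

/-- The pointwise Jensen-type inequality for the Ornstein-Uhlenbeck semigroup, uniform in time. -/
lemma ouLint_rpow_le {p : EuclideanSpace ℝ (Fin d) → ℝ} (hp : PGaussInf p)
    (hLH : LH0 p) : ∃ C : ℝ≥0, ∀ s : ℝ, 0 < s → ∀ φ : EuclideanSpace ℝ (Fin d) → ℝ≥0∞,
      Measurable φ → ∫⁻ y, φ y ^ p y ∂(gaussMeasure d) ≤ 1 →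
      ∀ x, ouLint s φ x ^ p x ≤ C * (1 + ouLint s (fun y => φ y ^ p y) x) := by
  obtain ⟨C, hC⟩ := ouLint_rpow_le_of_eq_zero_or_one_le hp hLH
  obtain ⟨P, hP⟩ := hLH.exists_le
  have hP0 : 0 ≤ P := by linarith [hP 0, hp.one_le 0]
  refine ⟨2 ^ P * (1 + C), fun s hs φ hφm hmod x => ?_⟩
  rw [ENNReal.coe_mul, ENNReal.coe_rpow_of_nonneg _ hP0]
  push_cast
  -- Values of `φ` below 1 contribute at most 1 to the average, since the kernel has mass one.
  set ψ := {y | 1 ≤ φ y}.indicator φ with hψ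
  have hsm : MeasurableSet {y | 1 ≤ φ y} := measurableSet_le measurable_const hφm
  have hψm : Measurable ψ := hφm.indicator hsm
  have hψφ : ∀ y, ψ y ≤ φ y := fun y => Set.indicator_le_self _ _ _
  have hψ' : ∀ y, ψ y = 0 ∨ 1 ≤ ψ y := by
    intro y
    by_cases hy : y ∈ {y | 1 ≤ φ y}
    · right; rw [hψ, Set.indicator_of_mem hy]; exact hy
    · left; rw [hψ, Set.indicator_of_notMem hy]
  have hψp : ∀ y, ψ y ^ p y ≤ φ y ^ p y := fun y =>
    ENNReal.rpow_le_rpow (hψφ y) (by linarith [hp.one_le y])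
  have hle : ∀ y, φ y ≤ 1 + ψ y := by
    intro y
    by_cases hy : y ∈ {y | 1 ≤ φ y}
    · rw [hψ, Set.indicator_of_mem hy]; exact le_add_self
    · exact (not_le.1 hy).le.trans le_self_add
  have hT : ouLint s φ x ≤ 1 + ouLint s ψ x := by
    calc ouLint s φ x ≤ ∫⁻ y, ENNReal.ofReal (mehlerKer s x y) * (1 + ψ y) ∂(gaussMeasure d) :=
          lintegral_mono fun y => by gcongr; exact hle y
      _ = _ := by
          simp_rw [mul_add, mul_one]
          rw [lintegral_add_left (measurable_mehlerKer_right s x), lintegral_mehlerKer hs]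
          rfl
  calc ouLint s φ x ^ p x ≤ (1 + ouLint s ψ x) ^ p x :=
        ENNReal.rpow_le_rpow hT (by linarith [hp.one_le x])
    _ ≤ 2 ^ P * (1 ^ p x + ouLint s ψ x ^ p x) := add_rpow_le_two_rpow_mul (hp.one_le x) (hP x)
    _ ≤ 2 ^ P * (1 + C * (1 + ouLint s (fun y => φ y ^ p y) x)) := by
        rw [ENNReal.one_rpow]
        gcongr
        refine (hC s hs ψ hψm hψ' ((lintegral_mono hψp).trans hmod) x).trans ?_
        gcongr
        exact lintegral_mono fun y => by gcongr; exact hψp y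
    _ ≤ _ := by
        rw [mul_assoc]
        gcongr
        rw [add_mul, one_mul]
        gcongr
        exact le_self_add

end Pointwise

/-! ### The one-sided 1/2-stable densities and their convolution semigroup. -/

section Subordinator

/-- The density of the one-sided stable law of index `1/2`; it vanishes for `v ≤ 0`. -/
def subDens (t v : ℝ) : ℝ :=
  t / (2 * Real.sqrt Real.pi * (v * Real.sqrt v)) * Real.exp (-(t ^ 2 / (4 * v)))

/-- Here the square root of a nonpositive number is 0 and division by 0 gives 0. Integrals over
$(0,\infty)$ can thus be taken over all of $\mathbb R$. -/
lemma subDens_of_nonpos (t : ℝ) {v : ℝ} (hv : v ≤ 0) : subDens t v = 0 := by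
  simp [subDens, Real.sqrt_eq_zero_of_nonpos hv]

lemma subDens_nonneg {t : ℝ} (ht : 0 < t) (v : ℝ) : 0 ≤ subDens t v := by
  rcases le_or_gt v 0 with hv | hv
  · rw [subDens_of_nonpos t hv]
  · unfold subDens; positivity

@[fun_prop]
lemma measurable_subDens {β : Type*} [MeasurableSpace β] {t v : β → ℝ} (ht : Measurable t)
    (hv : Measurable v) : Measurable fun b => subDens (t b) (v b) := by
  unfold subDens; fun_prop

lemma image_div_Ioi {c : ℝ} (hc : 0 < c) : (fun v : ℝ => c / v) '' Ioi 0 = Ioi 0 := by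
  ext u
  simp only [mem_image, mem_Ioi]
  refine ⟨fun ⟨v, hv, h⟩ => h ▸ by positivity, fun hu => ⟨c / u, by positivity, by field_simp⟩⟩

lemma injOn_div_Ioi {c : ℝ} (hc : 0 < c) : InjOn (fun v : ℝ => c / v) (Ioi 0) := by
  intro u hu v hv h
  simp only [mem_Ioi] at hu hv
  have : c / u = c / v := h
  field_simp at this
  exact this.symm

lemma hasDerivWithinAt_div_Ioi (c : ℝ) (v : ℝ) (hv : v ∈ Ioi (0 : ℝ)) :
    HasDerivWithinAt (fun v : ℝ => c / v) (-(c / v ^ 2)) (Ioi 0) v := by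
  have hv' : v ≠ 0 := ne_of_gt hv
  have := ((hasDerivAt_inv hv').const_mul c).hasDerivWithinAt (s := Ioi 0)
  simpa [div_eq_mul_inv] using this

lemma abs_deriv_mul_exp_div_sqrt {t v : ℝ} (ht : 0 < t) (hv : 0 < v) :
    |-(t ^ 2 / 4 / v ^ 2)| *
      (Real.exp (-(t ^ 2 / 4 / v)) / Real.sqrt (t ^ 2 / 4 / v)) =
      Real.sqrt Real.pi * subDens t v := by
  have h1 : Real.sqrt (t ^ 2 / 4 / v) = t / 2 / Real.sqrt v := by
    rw [Real.sqrt_div (by positivity), show t ^ 2 / 4 = (t / 2) ^ 2 by ring,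
      Real.sqrt_sq (by positivity)]
  have h2 : 0 < Real.sqrt v := Real.sqrt_pos.2 hv
  have h3 : Real.sqrt v ^ 2 = v := Real.sq_sqrt hv.le
  have h4 : 0 < Real.sqrt Real.pi := Real.sqrt_pos.2 Real.pi_pos
  rw [abs_neg, abs_of_nonneg (by positivity), h1, subDens, div_div (t ^ 2)]
  field_simp
  rw [h3]
  norm_num

/-- The substitution $v=t^2/(4u)$ moves the dependence on $t$ from the semigroup to an explicit
density. -/
lemma lintegral_exp_div_sqrt_mul {t : ℝ} (ht : 0 < t) (φ : ℝ → ℝ≥0∞) :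
    ∫⁻ u in Ioi (0 : ℝ), ENNReal.ofReal (Real.exp (-u) / Real.sqrt u) * φ (t ^ 2 / (4 * u)) =
      ENNReal.ofReal (Real.sqrt Real.pi) *
        ∫⁻ v in Ioi (0 : ℝ), ENNReal.ofReal (subDens t v) * φ v := by
  have hc : 0 < t ^ 2 / 4 := by positivity
  have h := lintegral_image_eq_lintegral_abs_deriv_mul measurableSet_Ioi
    (hasDerivWithinAt_div_Ioi (t ^ 2 / 4)) (injOn_div_Ioi hc)
    (fun u => ENNReal.ofReal (Real.exp (-u) / Real.sqrt u) * φ (t ^ 2 / (4 * u)))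
  rw [image_div_Ioi hc] at h
  rw [h, ← lintegral_const_mul' _ _ ENNReal.ofReal_ne_top]
  refine setLIntegral_congr_fun measurableSet_Ioi fun v hv => ?_
  simp only [mem_Ioi] at hv
  have e : t ^ 2 / (4 * (t ^ 2 / 4 / v)) = v := by field_simp
  rw [e, ← mul_assoc, ← mul_assoc, ← ENNReal.ofReal_mul (abs_nonneg _),
    ← ENNReal.ofReal_mul (Real.sqrt_nonneg _), abs_deriv_mul_exp_div_sqrt ht hv]

lemma integral_exp_div_sqrt_mul {t : ℝ} (ht : 0 < t) (φ : ℝ → ℝ) :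
    ∫ u in Ioi (0 : ℝ), Real.exp (-u) / Real.sqrt u * φ (t ^ 2 / (4 * u)) =
      Real.sqrt Real.pi * ∫ v in Ioi (0 : ℝ), subDens t v * φ v := by
  have hc : 0 < t ^ 2 / 4 := by positivity
  have h := integral_image_eq_integral_abs_deriv_smul measurableSet_Ioi
    (hasDerivWithinAt_div_Ioi (t ^ 2 / 4)) (injOn_div_Ioi hc)
    (fun u => Real.exp (-u) / Real.sqrt u * φ (t ^ 2 / (4 * u)))
  rw [image_div_Ioi hc] at h
  rw [h, ← integral_const_mul]
  refine setIntegral_congr_fun measurableSet_Ioi fun v hv => ?_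
  simp only [mem_Ioi] at hv
  have e : t ^ 2 / (4 * (t ^ 2 / 4 / v)) = v := by field_simp
  rw [e, smul_eq_mul, ← mul_assoc, ← mul_assoc, abs_deriv_mul_exp_div_sqrt ht hv]

lemma integrableOn_exp_div_sqrt_mul_iff {t : ℝ} (ht : 0 < t) (φ : ℝ → ℝ) :
    IntegrableOn (fun u => Real.exp (-u) / Real.sqrt u * φ (t ^ 2 / (4 * u))) (Ioi 0) ↔
      IntegrableOn (fun v => subDens t v * φ v) (Ioi 0) := by
  have hc : 0 < t ^ 2 / 4 := by positivity
  have h := integrableOn_image_iff_integrableOn_abs_deriv_smul measurableSet_Ioi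
    (hasDerivWithinAt_div_Ioi (t ^ 2 / 4)) (injOn_div_Ioi hc)
    (fun u => Real.exp (-u) / Real.sqrt u * φ (t ^ 2 / (4 * u)))
  rw [image_div_Ioi hc] at h
  have hpi : IsUnit (Real.sqrt Real.pi) := (Real.sqrt_pos.2 Real.pi_pos).ne'.isUnit
  rw [h, IntegrableOn, IntegrableOn, ← integrable_const_mul_iff hpi (fun v => subDens t v * φ v)]
  refine integrableOn_congr_fun (fun v hv => ?_) measurableSet_Ioi
  simp only [mem_Ioi] at hv
  have e : t ^ 2 / (4 * (t ^ 2 / 4 / v)) = v := by field_simp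
  rw [e, smul_eq_mul, ← mul_assoc, ← mul_assoc, abs_deriv_mul_exp_div_sqrt ht hv]

lemma setLIntegral_subDens_mul (t : ℝ) (φ : ℝ → ℝ≥0∞) :
    ∫⁻ v in Ioi (0 : ℝ), ENNReal.ofReal (subDens t v) * φ v =
      ∫⁻ v, ENNReal.ofReal (subDens t v) * φ v := by
  refine setLIntegral_eq_of_support_subset ?_
  intro v hv
  by_contra h
  simp [subDens_of_nonpos t (not_lt.1 h)] at hv

lemma lintegral_subDens {t : ℝ} (ht : 0 < t) : ∫⁻ v, ENNReal.ofReal (subDens t v) = 1 := by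
  have h := lintegral_exp_div_sqrt_mul ht (fun _ => 1)
  rw [setLIntegral_subDens_mul] at h
  simp only [mul_one] at h
  have hG : ∫⁻ u in Ioi (0 : ℝ), ENNReal.ofReal (Real.exp (-u) / Real.sqrt u) =
      ENNReal.ofReal (Real.sqrt Real.pi) := by
    rw [← Real.Gamma_one_half_eq, Real.Gamma_eq_integral (by norm_num),
      ofReal_integral_eq_lintegral_ofReal (Real.GammaIntegral_convergent (by norm_num))]
    · refine setLIntegral_congr_fun measurableSet_Ioi fun u hu => ?_
      simp only [mem_Ioi] at hu
      rw [show (1 / 2 - 1 : ℝ) = -(1 / 2) by norm_num, Real.rpow_neg hu.le,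
        ← Real.sqrt_eq_rpow, div_eq_mul_inv]
    · filter_upwards [ae_restrict_mem measurableSet_Ioi] with u hu
      simp only [mem_Ioi] at hu
      simp only [Pi.zero_apply]
      positivity
  rw [hG] at h
  have hpi : ENNReal.ofReal (Real.sqrt Real.pi) ≠ 0 := by
    simpa using Real.sqrt_pos.2 Real.pi_pos
  exact ((ENNReal.mul_eq_left hpi ENNReal.ofReal_ne_top).1 h.symm)

/-- Cauchy-Schlömilch substitution. -/
lemma lintegral_exp_sq_sub_div {r s c : ℝ} (hr : 0 < r) (hs : 0 < s) (hc : 0 < c) :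
    ∫⁻ w in Ioi (0 : ℝ), ENNReal.ofReal ((1 + 1 / w ^ 2) *
      Real.exp (-c * (r * w - s / w) ^ 2)) =
      ENNReal.ofReal (Real.sqrt (Real.pi / c) * ((r + s) / (2 * (r * s)))) := by
  set e : ℝ → ℝ≥0∞ := fun w => ENNReal.ofReal (Real.exp (-c * (r * w - s / w) ^ 2)) with he
  have hem : Measurable e := by fun_prop
  set I₁ := ∫⁻ w in Ioi (0 : ℝ), e w with hI₁
  set I₂ := ∫⁻ w in Ioi (0 : ℝ), ENNReal.ofReal (1 / w ^ 2) * e w with hI₂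
  -- The involution $w\mapsto s/(rw)$ changes the sign of $rw-s/w$ and exchanges the two integrals.
  have h12 : ENNReal.ofReal r * I₁ = ENNReal.ofReal s * I₂ := by
    have hsr : 0 < s / r := by positivity
    have h := lintegral_image_eq_lintegral_abs_deriv_mul measurableSet_Ioi
      (hasDerivWithinAt_div_Ioi (s / r)) (injOn_div_Ioi hsr) e
    rw [image_div_Ioi hsr] at h
    rw [hI₁, h, ← lintegral_const_mul' _ _ ENNReal.ofReal_ne_top,
      ← lintegral_const_mul' _ _ ENNReal.ofReal_ne_top]
    refine setLIntegral_congr_fun measurableSet_Ioi fun w hw => ?_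
    simp only [mem_Ioi] at hw
    have e1 : r * (s / r / w) - s / (s / r / w) = -(r * w - s / w) := by field_simp; ring
    simp only [he]
    rw [e1, neg_sq, ← mul_assoc, ← mul_assoc, ← ENNReal.ofReal_mul hr.le,
      ← ENNReal.ofReal_mul hs.le, abs_neg, abs_of_nonneg (by positivity)]
    congr 2
    field_simp
  -- The map $w\mapsto rw-s/w$ is a bijection of $(0,\infty)$ onto $\mathbb R$ with derivative
  -- $r+s/w^2$, so the combination is a Gaussian integral.
  have hsum : ENNReal.ofReal r * I₁ + ENNReal.ofReal s * I₂ =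
      ENNReal.ofReal (Real.sqrt (Real.pi / c)) := by
    have hderiv : ∀ w ∈ Ioi (0 : ℝ), HasDerivWithinAt (fun w : ℝ => r * w - s / w)
        (r + s / w ^ 2) (Ioi 0) w := fun w hw => by
      have := (((hasDerivAt_id w).const_mul r).hasDerivWithinAt (s := Ioi 0)).fun_sub
        (hasDerivWithinAt_div_Ioi s w hw)
      simpa using this
    have hinj : InjOn (fun w : ℝ => r * w - s / w) (Ioi 0) := by
      refine StrictMonoOn.injOn fun u hu w hw huw => ?_
      simp only [mem_Ioi] at hu hw
      have : s / w < s / u := by gcongr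
      have : r * u < r * w := by gcongr
      linarith
    have himg : (fun w : ℝ => r * w - s / w) '' Ioi 0 = univ := by
      refine eq_univ_of_forall fun y => ?_
      have hsq : Real.sqrt (y ^ 2 + 4 * (r * s)) ^ 2 = y ^ 2 + 4 * (r * s) :=
        Real.sq_sqrt (by positivity)
      have hlt : -y < Real.sqrt (y ^ 2 + 4 * (r * s)) := by
        refine Real.lt_sqrt_of_sq_lt ?_
        rw [neg_sq]
        have : 0 < 4 * (r * s) := by positivity
        linarith
      set q := Real.sqrt (y ^ 2 + 4 * (r * s))
      have hw : 0 < y + q := by linarith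
      refine ⟨(y + q) / (2 * r), by simp only [mem_Ioi]; positivity, ?_⟩
      beta_reduce
      field_simp
      nlinarith
    have h := lintegral_image_eq_lintegral_abs_deriv_mul measurableSet_Ioi hderiv hinj
      (fun y => ENNReal.ofReal (Real.exp (-c * y ^ 2)))
    rw [himg, Measure.restrict_univ, ← ofReal_integral_eq_lintegral_ofReal
      (integrable_exp_neg_mul_sq hc) (Filter.Eventually.of_forall fun _ => Real.exp_nonneg _),
      integral_gaussian] at h
    rw [h, ← lintegral_const_mul' _ _ ENNReal.ofReal_ne_top,
      ← lintegral_const_mul' _ _ ENNReal.ofReal_ne_top,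
      ← lintegral_add_left (by fun_prop)]
    refine setLIntegral_congr_fun measurableSet_Ioi fun w hw => ?_
    simp only [mem_Ioi] at hw
    rw [← mul_assoc, ← add_mul, ← ENNReal.ofReal_mul hs.le,
      ← ENNReal.ofReal_add hr.le (by positivity), abs_of_nonneg (by positivity)]
    congr 2
    ring
  have hS : 0 ≤ Real.sqrt (Real.pi / c) := Real.sqrt_nonneg _
  have hI₁v : I₁ = ENNReal.ofReal (Real.sqrt (Real.pi / c) / (2 * r)) := by
    have : ENNReal.ofReal (2 * r) * I₁ = ENNReal.ofReal (Real.sqrt (Real.pi / c)) := by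
      rw [← hsum, ← h12, ← two_mul, ENNReal.ofReal_mul zero_le_two, mul_assoc]
      simp
    rw [ENNReal.ofReal_div_of_pos (by positivity), ← this, mul_comm,
      ENNReal.mul_div_cancel_right (by simpa using hr) ENNReal.ofReal_ne_top]
  have hI₂v : I₂ = ENNReal.ofReal (Real.sqrt (Real.pi / c) / (2 * s)) := by
    have : ENNReal.ofReal (2 * s) * I₂ = ENNReal.ofReal (Real.sqrt (Real.pi / c)) := by
      rw [← hsum, h12, ← two_mul, ENNReal.ofReal_mul zero_le_two, mul_assoc]
      simp
    rw [ENNReal.ofReal_div_of_pos (by positivity), ← this, mul_comm,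
      ENNReal.mul_div_cancel_right (by simpa using hs) ENNReal.ofReal_ne_top]
  calc _ = I₁ + I₂ := by
        rw [hI₁, hI₂, ← lintegral_add_left hem]
        refine setLIntegral_congr_fun measurableSet_Ioi fun w hw => ?_
        simp only [mem_Ioi] at hw
        rw [ENNReal.ofReal_mul (by positivity), ENNReal.ofReal_add zero_le_one (by positivity),
          add_mul, ENNReal.ofReal_one, one_mul]
    _ = _ := by
        rw [hI₁v, hI₂v, ← ENNReal.ofReal_add (by positivity) (by positivity)]
        congr 1
        field_simp
        ring

/-- With $a=v/(1+w^2)$ one has $r^2/a+s^2/(v-a)=((r+s)^2+(rw-s/w)^2)/v$. The first term gives the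
exponential of the density at time $r+s$; the second is integrated by Cauchy–Schlömilch. -/
lemma lintegral_subDens_mul_subDens {r s : ℝ} (hr : 0 < r) (hs : 0 < s) (v : ℝ) :
    ∫⁻ a, ENNReal.ofReal (subDens r a) * ENNReal.ofReal (subDens s (v - a)) =
      ENNReal.ofReal (subDens (r + s) v) := by
  have hsupp : ∫⁻ a in Ioo 0 v, ENNReal.ofReal (subDens r a) *
      ENNReal.ofReal (subDens s (v - a)) =
      ∫⁻ a, ENNReal.ofReal (subDens r a) * ENNReal.ofReal (subDens s (v - a)) := by
    refine setLIntegral_eq_of_support_subset fun a ha => ?_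
    by_contra h
    rw [mem_Ioo, not_and_or, not_lt, not_lt] at h
    rcases h with h | h
    · simp [subDens_of_nonpos r h] at ha
    · simp [subDens_of_nonpos s (sub_nonpos.2 h)] at ha
  rw [← hsupp]
  rcases le_or_gt v 0 with hv | hv
  · simp [subDens_of_nonpos _ hv, Ioo_eq_empty (not_lt.2 hv)]
  have himg : (fun w : ℝ => v / (1 + w ^ 2)) '' Ioi 0 = Ioo 0 v := by
    ext a
    simp only [mem_image, mem_Ioi, mem_Ioo]
    constructor
    · rintro ⟨w, hw, rfl⟩
      refine ⟨by positivity, ?_⟩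
      rw [div_lt_iff₀ (by positivity)]
      nlinarith [mul_pos hv (pow_pos hw 2)]
    · rintro ⟨h0, h1⟩
      have h2 : 0 < v / a - 1 := by
        rw [sub_pos, lt_div_iff₀ h0]; linarith
      refine ⟨Real.sqrt (v / a - 1), Real.sqrt_pos.2 h2, ?_⟩
      rw [Real.sq_sqrt h2.le]
      field_simp
      ring
  have hinj : InjOn (fun w : ℝ => v / (1 + w ^ 2)) (Ioi 0) := by
    intro u hu w hw h
    simp only [mem_Ioi] at hu hw
    have h' : v / (1 + u ^ 2) = v / (1 + w ^ 2) := h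
    rw [div_eq_div_iff (by positivity) (by positivity)] at h'
    have h2 : w ^ 2 = u ^ 2 := by
      have := mul_left_cancel₀ hv.ne' h'
      linarith
    exact ((pow_left_inj₀ hw.le hu.le two_ne_zero).1 h2).symm
  have hderiv : ∀ w ∈ Ioi (0 : ℝ), HasDerivWithinAt (fun w : ℝ => v / (1 + w ^ 2))
      (-(v * (2 * w)) / (1 + w ^ 2) ^ 2) (Ioi 0) w := fun w _ => by
    have h1 : HasDerivAt (fun w : ℝ => 1 + w ^ 2) (2 * w) w := by
      simpa using (hasDerivAt_pow 2 w).const_add 1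
    have := (hasDerivAt_const w v).fun_div h1 (by positivity)
    simpa using this.hasDerivWithinAt (s := Ioi 0)
  have h := lintegral_image_eq_lintegral_abs_deriv_mul measurableSet_Ioi hderiv hinj
    (fun a => ENNReal.ofReal (subDens r a) * ENNReal.ofReal (subDens s (v - a)))
  rw [himg] at h
  rw [h]
  set κ := r * s / (2 * Real.pi * v ^ 2) * Real.exp (-((r + s) ^ 2 / (4 * v))) with hκ
  have hκ0 : 0 ≤ κ := by positivity
  have key : ∀ w ∈ Ioi (0 : ℝ),
      ENNReal.ofReal |-(v * (2 * w)) / (1 + w ^ 2) ^ 2| *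
        (ENNReal.ofReal (subDens r (v / (1 + w ^ 2))) *
          ENNReal.ofReal (subDens s (v - v / (1 + w ^ 2)))) =
      ENNReal.ofReal κ * ENNReal.ofReal ((1 + 1 / w ^ 2) *
        Real.exp (-(1 / (4 * v)) * (r * w - s / w) ^ 2)) := by
    intro w hw
    simp only [mem_Ioi] at hw
    rw [← ENNReal.ofReal_mul (subDens_nonneg hr _), ← ENNReal.ofReal_mul (abs_nonneg _),
      ← ENNReal.ofReal_mul hκ0]
    congr 1
    have hb : v - v / (1 + w ^ 2) = v * w ^ 2 / (1 + w ^ 2) := by field_simp; ring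
    have hsq : Real.sqrt (v / (1 + w ^ 2)) * Real.sqrt (v * w ^ 2 / (1 + w ^ 2)) =
        v * w / (1 + w ^ 2) := by
      rw [← Real.sqrt_mul (by positivity), ← Real.sqrt_sq (by positivity : 0 ≤ v * w / (1 + w ^ 2))]
      congr 1
      field_simp
    have hpi : Real.sqrt Real.pi * Real.sqrt Real.pi = Real.pi :=
      Real.mul_self_sqrt Real.pi_pos.le
    have hexp : Real.exp (-(r ^ 2 / (4 * (v / (1 + w ^ 2))))) *
        Real.exp (-(s ^ 2 / (4 * (v * w ^ 2 / (1 + w ^ 2))))) =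
        Real.exp (-((r + s) ^ 2 / (4 * v))) *
          Real.exp (-(1 / (4 * v)) * (r * w - s / w) ^ 2) := by
      rw [← Real.exp_add, ← Real.exp_add]
      congr 1
      field_simp
      ring
    rw [hb, neg_div, abs_neg, abs_of_nonneg (by positivity), hκ]
    unfold subDens
    have h1 : 0 < Real.sqrt (v / (1 + w ^ 2)) := Real.sqrt_pos.2 (by positivity)
    have h2 : 0 < Real.sqrt (v * w ^ 2 / (1 + w ^ 2)) := Real.sqrt_pos.2 (by positivity)
    have h3 : 0 < Real.sqrt Real.pi := Real.sqrt_pos.2 Real.pi_pos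
    set A := Real.sqrt (v / (1 + w ^ 2))
    set B := Real.sqrt (v * w ^ 2 / (1 + w ^ 2))
    calc v * (2 * w) / (1 + w ^ 2) ^ 2 *
        (r / (2 * Real.sqrt Real.pi * (v / (1 + w ^ 2) * A)) *
            Real.exp (-(r ^ 2 / (4 * (v / (1 + w ^ 2))))) *
          (s / (2 * Real.sqrt Real.pi * (v * w ^ 2 / (1 + w ^ 2) * B)) *
            Real.exp (-(s ^ 2 / (4 * (v * w ^ 2 / (1 + w ^ 2)))))))
        = v * (2 * w) / (1 + w ^ 2) ^ 2 *
          (r * s / (4 * (Real.sqrt Real.pi * Real.sqrt Real.pi) *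
            ((v / (1 + w ^ 2)) * (v * w ^ 2 / (1 + w ^ 2)) * (A * B)))) *
          (Real.exp (-(r ^ 2 / (4 * (v / (1 + w ^ 2))))) *
            Real.exp (-(s ^ 2 / (4 * (v * w ^ 2 / (1 + w ^ 2)))))) := by
          field_simp
          ring
      _ = _ := by
          rw [hexp, hsq, hpi]
          field_simp
          ring
  rw [setLIntegral_congr_fun measurableSet_Ioi key,
    lintegral_const_mul' _ _ ENNReal.ofReal_ne_top,
    lintegral_exp_sq_sub_div hr hs (by positivity), ← ENNReal.ofReal_mul hκ0]
  congr 1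
  have h4 : Real.sqrt (Real.pi / (1 / (4 * v))) = 2 * Real.sqrt Real.pi * Real.sqrt v := by
    rw [show Real.pi / (1 / (4 * v)) = 2 ^ 2 * (Real.pi * v) by field_simp; norm_num,
      Real.sqrt_mul (by norm_num), Real.sqrt_sq (by norm_num), Real.sqrt_mul Real.pi_pos.le,
      mul_assoc]
  have h3 : 0 < Real.sqrt Real.pi := Real.sqrt_pos.2 Real.pi_pos
  have h5 : 0 < Real.sqrt v := Real.sqrt_pos.2 hv
  have hpi : Real.pi = Real.sqrt Real.pi ^ 2 := (Real.sq_sqrt Real.pi_pos.le).symm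
  have hvv : v = Real.sqrt v ^ 2 := (Real.sq_sqrt hv.le).symm
  rw [h4, hκ, subDens]
  set E := Real.exp (-((r + s) ^ 2 / (4 * v)))
  set R := Real.sqrt Real.pi
  set V := Real.sqrt v
  rw [hpi, hvv]
  field_simp

lemma lintegral_lintegral_subDens {r s : ℝ} (hr : 0 < r) (hs : 0 < s) {h : ℝ → ℝ≥0∞}
    (hh : Measurable h) :
    ∫⁻ a, ENNReal.ofReal (subDens r a) * ∫⁻ b, ENNReal.ofReal (subDens s b) * h (a + b) =
      ∫⁻ v, ENNReal.ofReal (subDens (r + s) v) * h v := by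
  have h1 : ∀ a, ∫⁻ b, ENNReal.ofReal (subDens s b) * h (a + b) =
      ∫⁻ v, ENNReal.ofReal (subDens s (v - a)) * h v := by
    intro a
    rw [← lintegral_sub_right_eq_self (fun b => ENNReal.ofReal (subDens s b) * h (a + b)) a]
    simp
  simp_rw [h1, ← lintegral_const_mul' _ _ (ENNReal.ofReal_ne_top)]
  rw [lintegral_lintegral_swap]
  · refine lintegral_congr fun v => ?_
    rw [← lintegral_subDens_mul_subDens hr hs v, ← lintegral_mul_const _ (by fun_prop)]
    simp_rw [mul_assoc]
  · exact (by fun_prop : Measurable _).aemeasurable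

end Subordinator

/-! ### Holomorphy in time and Cauchy estimates. -/

section Holomorphic

/-- The density `subDens` at a complex time. -/
def cSubDens (z : ℂ) (v : ℝ) : ℂ :=
  z / ((2 * Real.sqrt Real.pi * (v * Real.sqrt v) : ℝ) : ℂ) *
    Complex.exp (-(z ^ 2 / ((4 * v : ℝ) : ℂ)))

lemma cSubDens_ofReal (t v : ℝ) : cSubDens t v = (subDens t v : ℂ) := by
  unfold cSubDens subDens
  push_cast
  ring_nf

lemma cSubDens_of_nonpos (z : ℂ) {v : ℝ} (hv : v ≤ 0) : cSubDens z v = 0 := by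
  simp [cSubDens, Real.sqrt_eq_zero_of_nonpos hv]

lemma measurable_cSubDens (z : ℂ) : Measurable (cSubDens z) := by
  unfold cSubDens; fun_prop

/-- The radius $t/3$ keeps $\operatorname{Re}z^2$ comparable to $t^2$, so complex densities are
dominated by real ones at a smaller time. -/
lemma norm_bounds_of_mem_ball {t : ℝ} {z : ℂ} (hz : z ∈ Metric.ball (t : ℂ) (t / 3)) :
    ‖z‖ ≤ 4 / 3 * t ∧ t ^ 2 / 3 ≤ (z ^ 2).re := by
  rw [Metric.mem_ball, dist_eq_norm] at hz
  have ht : 0 < t := by linarith [norm_nonneg (z - t)]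
  constructor
  · have h := norm_add_le (z - t) (t : ℂ)
    rw [sub_add_cancel, Complex.norm_real, Real.norm_of_nonneg ht.le] at h
    linarith
  · have h1 := Complex.sq_norm_sub_sq_re (z - t)
    have h2 : ‖z - t‖ ^ 2 < (t / 3) ^ 2 := by gcongr
    simp only [Complex.sub_re, Complex.ofReal_re, Complex.sub_im, Complex.ofReal_im, sub_zero] at h1
    have h3 : (z ^ 2).re = z.re ^ 2 - z.im ^ 2 := by rw [pow_two, Complex.mul_re]; ring
    rw [h3]
    have h4 : (z.re - t) ^ 2 + z.im ^ 2 < (t / 3) ^ 2 := by linarith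
    nlinarith [sq_nonneg (z.re - 2 * t / 3), sq_nonneg (z.re - t), sq_nonneg z.im]

lemma norm_cexp_le_of_mem_ball {t v : ℝ} (hv : 0 < v) {z : ℂ}
    (hz : z ∈ Metric.ball (t : ℂ) (t / 3)) :
    ‖Complex.exp (-(z ^ 2 / ((4 * v : ℝ) : ℂ)))‖ ≤ Real.exp (-(t ^ 2 / 3 / (4 * v))) := by
  rw [Complex.norm_exp, Complex.neg_re, Complex.div_ofReal_re]
  refine Real.exp_le_exp.2 (neg_le_neg ?_)
  have := (norm_bounds_of_mem_ball hz).2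
  gcongr

lemma norm_cSubDens_le {t : ℝ} (ht : 0 < t) {z : ℂ} (hz : z ∈ Metric.ball (t : ℂ) (t / 3))
    (v : ℝ) : ‖cSubDens z v‖ ≤ 8 / 3 * subDens (t / 2) v := by
  rcases le_or_gt v 0 with hv | hv
  · simp [cSubDens_of_nonpos z hv, subDens_of_nonpos _ hv]
  unfold cSubDens subDens
  rw [norm_mul, norm_div, Complex.norm_real, Real.norm_of_nonneg (by positivity)]
  have h1 := (norm_bounds_of_mem_ball hz).1
  have h2 := norm_cexp_le_of_mem_ball hv hz
  have h3 : Real.exp (-(t ^ 2 / 3 / (4 * v))) ≤ Real.exp (-((t / 2) ^ 2 / (4 * v))) := by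
    refine Real.exp_le_exp.2 (neg_le_neg ?_)
    gcongr
    nlinarith
  calc ‖z‖ / (2 * Real.sqrt Real.pi * (v * Real.sqrt v)) *
        ‖Complex.exp (-(z ^ 2 / ((4 * v : ℝ) : ℂ)))‖
      ≤ (4 / 3 * t) / (2 * Real.sqrt Real.pi * (v * Real.sqrt v)) *
        Real.exp (-((t / 2) ^ 2 / (4 * v))) := by
        gcongr
        exact h2.trans h3
    _ = _ := by ring

lemma hasDerivAt_cSubDens (z : ℂ) (v : ℝ) :
    HasDerivAt (fun z => cSubDens z v)
      (1 / ((2 * Real.sqrt Real.pi * (v * Real.sqrt v) : ℝ) : ℂ) *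
        (1 - 2 * (z ^ 2 / ((4 * v : ℝ) : ℂ))) * Complex.exp (-(z ^ 2 / ((4 * v : ℝ) : ℂ)))) z := by
  have h1 : HasDerivAt (fun z : ℂ => -(z ^ 2 / ((4 * v : ℝ) : ℂ)))
      (-(2 * z / ((4 * v : ℝ) : ℂ))) z := by
    simpa using ((hasDerivAt_pow 2 z).div_const ((4 * v : ℝ) : ℂ)).fun_neg
  have h2 := ((hasDerivAt_id z).div_const
    ((2 * Real.sqrt Real.pi * (v * Real.sqrt v) : ℝ) : ℂ)).fun_mul h1.cexp
  unfold cSubDens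
  convert! h2 using 1
  simp only [id]
  ring

lemma norm_deriv_cSubDens_le {t : ℝ} (ht : 0 < t) {z : ℂ} (hz : z ∈ Metric.ball (t : ℂ) (t / 3))
    (v : ℝ) :
    ‖1 / ((2 * Real.sqrt Real.pi * (v * Real.sqrt v) : ℝ) : ℂ) *
        (1 - 2 * (z ^ 2 / ((4 * v : ℝ) : ℂ))) * Complex.exp (-(z ^ 2 / ((4 * v : ℝ) : ℂ)))‖ ≤
      60 / t * subDens (t / 4) v := by
  rcases le_or_gt v 0 with hv | hv
  · simp [subDens_of_nonpos _ hv, Real.sqrt_eq_zero_of_nonpos hv]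
  rw [norm_mul, norm_mul, norm_div, Complex.norm_real, Real.norm_of_nonneg (by positivity),
    norm_one]
  have h1 := (norm_bounds_of_mem_ball hz).1
  have h2 := norm_cexp_le_of_mem_ball hv hz
  set X := t ^ 2 / v with hX
  have hX0 : 0 ≤ X := by positivity
  have h4 : ‖1 - 2 * (z ^ 2 / ((4 * v : ℝ) : ℂ))‖ ≤ 1 + X := by
    refine (norm_sub_le _ _).trans ?_
    rw [norm_one, norm_mul, norm_div, norm_pow, Complex.norm_real,
      Real.norm_of_nonneg (by positivity), Complex.norm_ofNat, hX]
    gcongr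
    calc 2 * (‖z‖ ^ 2 / (4 * v)) ≤ 2 * ((4 / 3 * t) ^ 2 / (4 * v)) := by gcongr
      _ = 8 / 9 * (t ^ 2 / v) := by field_simp; norm_num
      _ ≤ _ := by linarith
  have h5 : (1 + X) * Real.exp (-(t ^ 2 / 3 / (4 * v))) ≤
      15 * Real.exp (-((t / 4) ^ 2 / (4 * v))) := by
    -- The exponent to spare is $1/12-1/64=13/192$, and $192/13<15$ lets it absorb the factor $1+X$.
    have e1 : -(t ^ 2 / 3 / (4 * v)) = -(13 / 192 * X) + -((t / 4) ^ 2 / (4 * v)) := by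
      rw [hX]; field_simp; norm_num
    rw [e1, Real.exp_add, ← mul_assoc]
    gcongr
    rw [Real.exp_neg, mul_inv_le_iff₀ (Real.exp_pos _)]
    linarith [Real.add_one_le_exp (13 / 192 * X)]
  calc 1 / (2 * Real.sqrt Real.pi * (v * Real.sqrt v)) * ‖1 - 2 * (z ^ 2 / ((4 * v : ℝ) : ℂ))‖ *
        ‖Complex.exp (-(z ^ 2 / ((4 * v : ℝ) : ℂ)))‖
      ≤ 1 / (2 * Real.sqrt Real.pi * (v * Real.sqrt v)) * (1 + X) *
        Real.exp (-(t ^ 2 / 3 / (4 * v))) := by gcongr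
    _ ≤ 1 / (2 * Real.sqrt Real.pi * (v * Real.sqrt v)) *
        (15 * Real.exp (-((t / 4) ^ 2 / (4 * v)))) := by
        rw [mul_assoc]
        gcongr
    _ = _ := by
        unfold subDens
        field_simp
        norm_num

variable {h : ℝ → ℝ}

lemma differentiableOn_integral_cSubDens (hm : Measurable h)
    (hint : ∀ t, 0 < t → Integrable fun v => subDens t v * h v) {t : ℝ} (ht : 0 < t) :
    DifferentiableOn ℂ (fun z => ∫ v, cSubDens z v * (h v : ℂ))
      (Metric.ball (t : ℂ) (t / 3)) := by
  intro z hz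
  have hmeas : ∀ z, AEStronglyMeasurable (fun v => cSubDens z v * (h v : ℂ)) volume := fun z =>
    ((measurable_cSubDens z).mul (by fun_prop)).aestronglyMeasurable
  have := (hasDerivAt_integral_of_dominated_loc_of_deriv_le (μ := volume)
    (F := fun z v => cSubDens z v * (h v : ℂ))
    (F' := fun z v => (1 / ((2 * Real.sqrt Real.pi * (v * Real.sqrt v) : ℝ) : ℂ) *
        (1 - 2 * (z ^ 2 / ((4 * v : ℝ) : ℂ))) * Complex.exp (-(z ^ 2 / ((4 * v : ℝ) : ℂ)))) *
        (h v : ℂ))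
    (bound := fun v => 60 / t * |subDens (t / 4) v * h v|)
    (Metric.isOpen_ball.mem_nhds hz) (Filter.Eventually.of_forall hmeas) ?_ ?_ ?_ ?_ ?_).2
  · exact this.differentiableAt.differentiableWithinAt
  · refine ((hint (t / 2) (by positivity)).abs.const_mul (8 / 3)).mono' (hmeas z) ?_
    refine Filter.Eventually.of_forall fun v => ?_
    rw [norm_mul, Complex.norm_real, Real.norm_eq_abs, abs_mul,
      abs_of_nonneg (subDens_nonneg (by positivity) v), ← mul_assoc]
    gcongr
    exact norm_cSubDens_le ht hz v
  · exact (by fun_prop : Measurable _).aestronglyMeasurable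
  · refine Filter.Eventually.of_forall fun v w hw => ?_
    rw [norm_mul, Complex.norm_real, Real.norm_eq_abs, abs_mul,
      abs_of_nonneg (subDens_nonneg (by positivity) v), ← mul_assoc (60 / t)]
    gcongr
    exact norm_deriv_cSubDens_le ht hw v
  · exact (hint (t / 4) (by positivity)).abs.const_mul _
  · exact Filter.Eventually.of_forall fun v w _ => (hasDerivAt_cSubDens w v).mul_const _

lemma analyticAt_integral_cSubDens (hm : Measurable h)
    (hint : ∀ t, 0 < t → Integrable fun v => subDens t v * h v) {t : ℝ} (ht : 0 < t) :
    AnalyticAt ℂ (fun z => ∫ v, cSubDens z v * (h v : ℂ)) t :=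
  (differentiableOn_integral_cSubDens hm hint ht).analyticAt
    (Metric.ball_mem_nhds _ (by positivity))

lemma integral_subDens_eq_re (t : ℝ) :
    ∫ v, subDens t v * h v = (∫ v, cSubDens t v * (h v : ℂ)).re := by
  simp_rw [cSubDens_ofReal, ← Complex.ofReal_mul]
  rw [show ∫ v, ((subDens t v * h v : ℝ) : ℂ) = ((∫ v, subDens t v * h v : ℝ) : ℂ) from
    integral_ofReal, Complex.ofReal_re]

lemma analyticAt_integral_subDens (hm : Measurable h)
    (hint : ∀ t, 0 < t → Integrable fun v => subDens t v * h v) {t : ℝ} (ht : 0 < t) :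
    AnalyticAt ℝ (fun t => ∫ v, subDens t v * h v) t := by
  simp_rw [integral_subDens_eq_re]
  exact (analyticAt_integral_cSubDens hm hint ht).re_ofReal

lemma iteratedDeriv_re_ofReal {F : ℂ → ℂ} (hF : ∀ t : ℝ, 0 < t → AnalyticAt ℂ F t) (k : ℕ) :
    ∀ t : ℝ, 0 < t → iteratedDeriv k (fun t : ℝ => (F t).re) t = (iteratedDeriv k F t).re := by
  induction k with
  | zero => intro t _; simp
  | succ k ih =>
    intro t ht
    rw [iteratedDeriv_succ, iteratedDeriv_succ]
    have h1 : iteratedDeriv k (fun t : ℝ => (F t).re) =ᶠ[nhds t]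
        fun t : ℝ => (iteratedDeriv k F t).re :=
      Filter.eventually_of_mem (Ioi_mem_nhds ht) ih
    rw [h1.deriv_eq]
    have h2 : AnalyticAt ℂ (iteratedDeriv k F) t := by
      rw [iteratedDeriv_eq_iterate]
      exact (hF t ht).iterated_deriv k
    exact h2.differentiableAt.hasDerivAt.real_of_complex.deriv

/-- Cauchy's estimate on the circle of radius $t/4$, which lies inside the ball of radius $t/3$
where the density at time $t/2$ dominates. -/
lemma abs_iteratedDeriv_integral_subDens_le (hm : Measurable h)
    (hint : ∀ t, 0 < t → Integrable fun v => subDens t v * h v) (k : ℕ) {t : ℝ} (ht : 0 < t) :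
    |iteratedDeriv k (fun t => ∫ v, subDens t v * h v) t| ≤
      8 / 3 * (k.factorial * 4 ^ k / t ^ k) * ∫ v, subDens (t / 2) v * |h v| := by
  simp_rw [integral_subDens_eq_re (h := h)]
  rw [iteratedDeriv_re_ofReal (fun t ht => analyticAt_integral_cSubDens hm hint ht) k t ht]
  refine (Complex.abs_re_le_norm _).trans ?_
  have hsub : Metric.closedBall (t : ℂ) (t / 4) ⊆ Metric.ball (t : ℂ) (t / 3) :=
    Metric.closedBall_subset_ball (by linarith)
  have hd := differentiableOn_integral_cSubDens hm hint ht
  refine (Complex.norm_iteratedDeriv_le_of_forall_mem_sphere_norm_le (R := t / 4)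
    (C := 8 / 3 * ∫ v, subDens (t / 2) v * |h v|) k (by positivity) ?_ ?_).trans (le_of_eq ?_)
  · exact (hd.mono hsub).diffContOnCl_ball subset_rfl
  · intro z hz
    have hz' := hsub (Metric.sphere_subset_closedBall hz)
    rw [← integral_const_mul]
    refine norm_integral_le_of_norm_le ?_ (Filter.Eventually.of_forall fun v => ?_)
    · have := (hint (t / 2) (by positivity)).abs.const_mul (8 / 3)
      simpa only [abs_mul, abs_of_nonneg (subDens_nonneg (half_pos ht) _)] using this
    · rw [norm_mul, Complex.norm_real, Real.norm_eq_abs, ← mul_assoc]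
      gcongr
      exact norm_cSubDens_le ht hz' v
  · rw [div_pow]
    field_simp

end Holomorphic

/-! ### The Poisson–Hermite kernel: semigroup law, finiteness, modular bound. -/

section Poisson

variable {d : ℕ}

/-- The Poisson-Hermite semigroup on `[0, ∞]`-valued functions. -/
def phLint (t : ℝ) (φ : EuclideanSpace ℝ (Fin d) → ℝ≥0∞) (x : EuclideanSpace ℝ (Fin d)) :
    ℝ≥0∞ :=
  ∫⁻ v, ENNReal.ofReal (subDens t v) * ouLint v φ x

/-- The kernel of the Poisson-Hermite semigroup with respect to the Gaussian measure. -/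
def phKer (t : ℝ) (x y : EuclideanSpace ℝ (Fin d)) : ℝ≥0∞ :=
  ∫⁻ v, ENNReal.ofReal (subDens t v) * ENNReal.ofReal (mehlerKer v x y)

lemma measurable_ofReal_subDens (t : ℝ) : Measurable fun v => ENNReal.ofReal (subDens t v) := by
  fun_prop

lemma subDens_mul_congr {t : ℝ} {a b : ℝ → ℝ≥0∞} (h : ∀ v, 0 < v → a v = b v) (v : ℝ) :
    ENNReal.ofReal (subDens t v) * a v = ENNReal.ofReal (subDens t v) * b v := by
  rcases le_or_gt v 0 with hv | hv
  · simp [subDens_of_nonpos t hv]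
  · rw [h v hv]

lemma subDens_mul_mono {t : ℝ} {a b : ℝ → ℝ≥0∞} (h : ∀ v, 0 < v → a v ≤ b v) (v : ℝ) :
    ENNReal.ofReal (subDens t v) * a v ≤ ENNReal.ofReal (subDens t v) * b v := by
  rcases le_or_gt v 0 with hv | hv
  · simp [subDens_of_nonpos t hv]
  · gcongr; exact h v hv

lemma phKer_comm (t : ℝ) (x y : EuclideanSpace ℝ (Fin d)) : phKer t x y = phKer t y x := by
  simp_rw [phKer, mehlerKer_comm _ x y]

@[fun_prop]
lemma measurable_phKer {β : Type*} [MeasurableSpace β] (t : ℝ)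
    {x y : β → EuclideanSpace ℝ (Fin d)} (hx : Measurable x) (hy : Measurable y) :
    Measurable fun b => phKer t (x b) (y b) := by
  unfold phKer
  exact Measurable.lintegral_prod_right'
    (f := fun q : β × ℝ =>
      ENNReal.ofReal (subDens t q.2) * ENNReal.ofReal (mehlerKer q.2 (x q.1) (y q.1)))
    (by fun_prop)

lemma ouLint_congr_ae {φ ψ : EuclideanSpace ℝ (Fin d) → ℝ≥0∞} (h : φ =ᵐ[gaussMeasure d] ψ)
    (s : ℝ) (x : EuclideanSpace ℝ (Fin d)) : ouLint s φ x = ouLint s ψ x :=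
  lintegral_congr_ae (h.mono fun y hy => by simp only [hy])

lemma phLint_congr_ae {φ ψ : EuclideanSpace ℝ (Fin d) → ℝ≥0∞} (h : φ =ᵐ[gaussMeasure d] ψ)
    (s : ℝ) (x : EuclideanSpace ℝ (Fin d)) : phLint s φ x = phLint s ψ x := by
  simp_rw [phLint, ouLint_congr_ae h]

lemma measurable_ouLint {φ : EuclideanSpace ℝ (Fin d) → ℝ≥0∞} (hφ : Measurable φ)
    (x : EuclideanSpace ℝ (Fin d)) : Measurable fun v => ouLint v φ x := by
  unfold ouLint
  exact Measurable.lintegral_prod_right'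
    (f := fun q : ℝ × EuclideanSpace ℝ (Fin d) =>
      ENNReal.ofReal (mehlerKer q.1 x q.2) * φ q.2) (by fun_prop)

lemma phLint_eq_lintegral_phKer {φ : EuclideanSpace ℝ (Fin d) → ℝ≥0∞} (hφ : Measurable φ)
    (t : ℝ) (x : EuclideanSpace ℝ (Fin d)) :
    phLint t φ x = ∫⁻ y, phKer t x y * φ y ∂(gaussMeasure d) := by
  unfold phLint ouLint phKer
  simp_rw [← lintegral_const_mul' _ _ ENNReal.ofReal_ne_top]
  rw [lintegral_lintegral_swap]
  · refine lintegral_congr fun y => ?_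
    simp_rw [← mul_assoc]
    rw [lintegral_mul_const _ (by fun_prop)]
  · exact (by fun_prop : Measurable _).aemeasurable

lemma lintegral_phKer {t : ℝ} (ht : 0 < t) (x : EuclideanSpace ℝ (Fin d)) :
    ∫⁻ y, phKer t x y ∂(gaussMeasure d) = 1 := by
  have h := phLint_eq_lintegral_phKer (d := d) (φ := fun _ => 1) measurable_const t x
  simp only [mul_one] at h
  rw [← h, phLint, lintegral_congr (subDens_mul_congr (b := fun _ => 1) fun v hv => ?_)]
  · simpa only [mul_one] using lintegral_subDens ht
  · simp only [ouLint, mul_one, lintegral_mehlerKer hv]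

/-- Invariance of $\gamma_d$: the kernel is symmetric with mass one. -/
lemma lintegral_phLint {φ : EuclideanSpace ℝ (Fin d) → ℝ≥0∞} (hφ : Measurable φ) {t : ℝ}
    (ht : 0 < t) : ∫⁻ x, phLint t φ x ∂(gaussMeasure d) = ∫⁻ y, φ y ∂(gaussMeasure d) := by
  simp_rw [phLint_eq_lintegral_phKer hφ]
  rw [lintegral_lintegral_swap]
  · refine lintegral_congr fun y => ?_
    rw [lintegral_mul_const _ (by fun_prop)]
    simp_rw [phKer_comm t _ y]
    rw [lintegral_phKer ht, one_mul]
  · exact (by fun_prop : Measurable _).aemeasurable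

lemma lintegral_phKer_mul_phKer {r s : ℝ} (hr : 0 < r) (hs : 0 < s)
    (x y : EuclideanSpace ℝ (Fin d)) :
    ∫⁻ z, phKer r x z * phKer s z y ∂(gaussMeasure d) = phKer (r + s) x y := by
  have h1 : ∫⁻ z, phKer r x z * phKer s z y ∂(gaussMeasure d) =
      phLint r (fun z => phKer s z y) x :=
    (phLint_eq_lintegral_phKer (by fun_prop) r x).symm
  have h2 : ∀ a, 0 < a → ouLint a (fun z => phKer s z y) x =
      ∫⁻ b, ENNReal.ofReal (subDens s b) * ENNReal.ofReal (mehlerKer (a + b) x y) := by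
    intro a ha
    unfold ouLint phKer
    simp_rw [← lintegral_const_mul' _ _ ENNReal.ofReal_ne_top]
    rw [lintegral_lintegral_swap]
    · refine lintegral_congr fun b => ?_
      simp_rw [mul_left_comm _ (ENNReal.ofReal (subDens s b))]
      rw [lintegral_const_mul' _ _ ENNReal.ofReal_ne_top]
      exact subDens_mul_congr
        (a := fun b => ∫⁻ z, ENNReal.ofReal (mehlerKer a x z) * ENNReal.ofReal (mehlerKer b z y)
          ∂(gaussMeasure d))
        (b := fun b => ENNReal.ofReal (mehlerKer (a + b) x y))
        (fun b hb => lintegral_mehlerKer_mul ha hb x y) b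
    · exact (by fun_prop : Measurable _).aemeasurable
  rw [h1, phLint, lintegral_congr (subDens_mul_congr h2)]
  exact lintegral_lintegral_subDens hr hs (h := fun v => ENNReal.ofReal (mehlerKer v x y))
    (by fun_prop)

lemma measurable_phLint {φ : EuclideanSpace ℝ (Fin d) → ℝ≥0∞} (hφ : Measurable φ) (t : ℝ) :
    Measurable (phLint t φ) := by
  have : phLint t φ = fun x => ∫⁻ y, phKer t x y * φ y ∂(gaussMeasure d) :=
    funext fun x => phLint_eq_lintegral_phKer hφ t x
  rw [this]
  exact Measurable.lintegral_prod_right'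
    (f := fun q : EuclideanSpace ℝ (Fin d) × EuclideanSpace ℝ (Fin d) => phKer t q.1 q.2 * φ q.2)
    (by fun_prop)

lemma phLint_phLint {φ : EuclideanSpace ℝ (Fin d) → ℝ≥0∞} (hφ : Measurable φ) {r s : ℝ}
    (hr : 0 < r) (hs : 0 < s) (x : EuclideanSpace ℝ (Fin d)) :
    phLint r (phLint s φ) x = phLint (r + s) φ x := by
  rw [phLint_eq_lintegral_phKer (measurable_phLint hφ s), phLint_eq_lintegral_phKer hφ]
  simp_rw [phLint_eq_lintegral_phKer hφ s]
  have h1 : ∀ z, phKer r x z * ∫⁻ y, phKer s z y * φ y ∂(gaussMeasure d) =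
      ∫⁻ y, phKer r x z * (phKer s z y * φ y) ∂(gaussMeasure d) := fun z =>
    (lintegral_const_mul _ (by fun_prop)).symm
  simp_rw [h1]
  rw [lintegral_lintegral_swap]
  · refine lintegral_congr fun y => ?_
    simp_rw [← mul_assoc]
    rw [lintegral_mul_const _ (by fun_prop), lintegral_phKer_mul_phKer hr hs]
  · exact (by fun_prop : Measurable _).aemeasurable

/-- The singularity of order $v^{-d/2}$ at small times is absorbed by part of $e^{-t^2/(4v)}$, at
the price of halving $t$. This makes $P_tf(x)$ finite at every point for every $f\in L^1(\gamma_d)$.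
-/
lemma subDens_mul_one_sub_exp_le (d : ℕ) {t : ℝ} (ht : 0 < t) : ∃ K : ℝ, 0 ≤ K ∧ ∀ v, 0 < v →
    subDens t v * (1 / (1 - Real.exp (-2 * v)) ^ ((d : ℝ) / 2)) ≤ K * subDens (t / 2) v := by
  -- Chosen so that $c/(2v)=t^2/(4v)-(t/2)^2/(4v)$, the part of the exponent given up.
  set c : ℝ := 3 * t ^ 2 / 8 with hc
  have hc0 : 0 < c := by positivity
  refine ⟨2 * ((d + 1).factorial / c ^ (d + 1) * Real.exp c), by positivity, fun v hv => ?_⟩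
  have h := one_sub_exp_pos hv
  set X := 1 / (2 * v) with hX
  have hX0 : 0 < X := by positivity
  have h1 : 1 / (1 - Real.exp (-2 * v)) ≤ 1 + X := by
    rw [div_le_iff₀ h]
    have h2 : Real.exp (-2 * v) * (1 + 2 * v) ≤ 1 := by
      calc Real.exp (-2 * v) * (1 + 2 * v) ≤ Real.exp (-2 * v) * Real.exp (2 * v) := by
            gcongr
            linarith [Real.add_one_le_exp (2 * v)]
        _ = 1 := by rw [← Real.exp_add]; simp
    have h3 : 1 ≤ (1 + X) * (1 - Real.exp (-2 * v)) ↔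
        2 * v ≤ (2 * v + 1) * (1 - Real.exp (-2 * v)) := by
      rw [hX, show 1 + 1 / (2 * v) = (2 * v + 1) / (2 * v) by field_simp, div_mul_eq_mul_div,
        le_div_iff₀ (by positivity), one_mul]
    rw [h3]
    linarith
  have h4 : 1 / (1 - Real.exp (-2 * v)) ^ ((d : ℝ) / 2) ≤ (1 + X) ^ (d + 1) := by
    calc 1 / (1 - Real.exp (-2 * v)) ^ ((d : ℝ) / 2)
        = (1 / (1 - Real.exp (-2 * v))) ^ ((d : ℝ) / 2) := by
          rw [Real.div_rpow zero_le_one h.le, Real.one_rpow]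
      _ ≤ (1 + X) ^ ((d : ℝ) / 2) := by gcongr
      _ ≤ (1 + X) ^ ((d + 1 : ℕ) : ℝ) := by
          refine Real.rpow_le_rpow_of_exponent_le (by linarith) ?_
          push_cast
          have : (0 : ℝ) ≤ d := by positivity
          linarith
      _ = _ := Real.rpow_natCast _ _
  have h5 : (1 + X) ^ (d + 1) ≤ (d + 1).factorial / c ^ (d + 1) * Real.exp c *
      Real.exp (c * X) := by
    have := Real.pow_div_factorial_le_exp (c * (1 + X)) (by positivity) (d + 1)
    rw [mul_pow, div_le_iff₀ (by positivity), mul_add, mul_one, Real.exp_add] at this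
    rw [div_mul_eq_mul_div, div_mul_eq_mul_div, le_div_iff₀ (by positivity)]
    linarith
  have h6 : Real.exp (-(t ^ 2 / (4 * v))) * Real.exp (c * X) =
      Real.exp (-((t / 2) ^ 2 / (4 * v))) := by
    rw [← Real.exp_add]
    congr 1
    rw [hc, hX]
    field_simp
    norm_num
  calc subDens t v * (1 / (1 - Real.exp (-2 * v)) ^ ((d : ℝ) / 2))
      ≤ subDens t v * ((d + 1).factorial / c ^ (d + 1) * Real.exp c * Real.exp (c * X)) := by
        have := subDens_nonneg ht v
        gcongr
        exact h4.trans h5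
    _ = (d + 1).factorial / c ^ (d + 1) * Real.exp c *
        (t / (2 * Real.sqrt Real.pi * (v * Real.sqrt v)) *
          (Real.exp (-(t ^ 2 / (4 * v))) * Real.exp (c * X))) := by
        unfold subDens; ring
    _ = _ := by
        rw [h6]
        unfold subDens
        ring

lemma ouLint_le {s : ℝ} (hs : 0 < s) (φ : EuclideanSpace ℝ (Fin d) → ℝ≥0∞)
    (x : EuclideanSpace ℝ (Fin d)) :
    ouLint s φ x ≤ ENNReal.ofReal (1 / (1 - Real.exp (-2 * s)) ^ ((d : ℝ) / 2) *
      Real.exp (‖x‖ ^ 2)) * ∫⁻ y, φ y ∂(gaussMeasure d) := by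
  rw [← lintegral_const_mul' _ _ ENNReal.ofReal_ne_top]
  refine lintegral_mono fun y => ?_
  gcongr
  exact mehlerKer_le hs x y

lemma phLint_lt_top {t : ℝ} (ht : 0 < t) {φ : EuclideanSpace ℝ (Fin d) → ℝ≥0∞}
    (hφ : ∫⁻ y, φ y ∂(gaussMeasure d) ≠ ⊤) (x : EuclideanSpace ℝ (Fin d)) :
    phLint t φ x < ⊤ := by
  obtain ⟨K, hK, h⟩ := subDens_mul_one_sub_exp_le d ht
  set I := ∫⁻ y, φ y ∂(gaussMeasure d)
  have hle : phLint t φ x ≤ ∫⁻ v, ENNReal.ofReal (subDens (t / 2) v) *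
      (ENNReal.ofReal (K * Real.exp (‖x‖ ^ 2)) * I) := by
    refine lintegral_mono fun v => ?_
    rcases le_or_gt v 0 with hv | hv
    · simp [subDens_of_nonpos t hv]
    have hpos := one_sub_exp_pos hv
    refine (mul_le_mul_right (ouLint_le hv φ x) _).trans ?_
    rw [← mul_assoc, ← mul_assoc, ← ENNReal.ofReal_mul (subDens_nonneg ht v),
      ← ENNReal.ofReal_mul (subDens_nonneg (half_pos ht) v)]
    refine mul_le_mul_left (ENNReal.ofReal_le_ofReal ?_) _
    rw [← mul_assoc]
    have := mul_le_mul_of_nonneg_right (h v hv) (Real.exp_pos (‖x‖ ^ 2)).le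
    linarith
  refine hle.trans_lt ?_
  rw [lintegral_mul_const _ (measurable_ofReal_subDens _), lintegral_subDens (half_pos ht), one_mul]
  exact ENNReal.mul_lt_top ENNReal.ofReal_lt_top hφ.lt_top

lemma phKer_lt_top {t : ℝ} (ht : 0 < t) (x y : EuclideanSpace ℝ (Fin d)) : phKer t x y < ⊤ := by
  obtain ⟨K, hK, h⟩ := subDens_mul_one_sub_exp_le d ht
  have hle : phKer t x y ≤ ∫⁻ v, ENNReal.ofReal (subDens (t / 2) v) *
      ENNReal.ofReal (K * Real.exp (‖x‖ ^ 2)) := by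
    refine lintegral_mono fun v => ?_
    rcases le_or_gt v 0 with hv | hv
    · simp [subDens_of_nonpos t hv]
    have hpos := one_sub_exp_pos hv
    beta_reduce
    rw [← ENNReal.ofReal_mul (subDens_nonneg ht v),
      ← ENNReal.ofReal_mul (subDens_nonneg (half_pos ht) v)]
    refine ENNReal.ofReal_le_ofReal ?_
    calc subDens t v * mehlerKer v x y
        ≤ subDens t v * (1 / (1 - Real.exp (-2 * v)) ^ ((d : ℝ) / 2) * Real.exp (‖x‖ ^ 2)) := by
          have := subDens_nonneg ht v
          gcongr
          exact mehlerKer_le hv x y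
      _ = subDens t v * (1 / (1 - Real.exp (-2 * v)) ^ ((d : ℝ) / 2)) * Real.exp (‖x‖ ^ 2) := by
          ring
      _ ≤ K * subDens (t / 2) v * Real.exp (‖x‖ ^ 2) :=
          mul_le_mul_of_nonneg_right (h v hv) (Real.exp_pos _).le
      _ = _ := by ring
  refine hle.trans_lt ?_
  rw [lintegral_mul_const _ (measurable_ofReal_subDens _), lintegral_subDens (half_pos ht), one_mul]
  exact ENNReal.ofReal_lt_top

/-- The quotient of the density by $t$ decreases in $t$. This supplies one dominating function for
all times near a given one. -/
lemma phLint_le_of_le {s t : ℝ} (hs : 0 < s) (hst : s ≤ t)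
    (φ : EuclideanSpace ℝ (Fin d) → ℝ≥0∞) (x : EuclideanSpace ℝ (Fin d)) :
    phLint t φ x ≤ ENNReal.ofReal (t / s) * phLint s φ x := by
  unfold phLint
  rw [← lintegral_const_mul' _ _ ENNReal.ofReal_ne_top]
  refine lintegral_mono fun v => ?_
  rcases le_or_gt v 0 with hv | hv
  · simp [subDens_of_nonpos t hv]
  have ht : 0 < t := hs.trans_le hst
  rw [← mul_assoc, ← ENNReal.ofReal_mul (by positivity)]
  gcongr
  unfold subDens
  calc t / (2 * Real.sqrt Real.pi * (v * Real.sqrt v)) * Real.exp (-(t ^ 2 / (4 * v)))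
      ≤ t / (2 * Real.sqrt Real.pi * (v * Real.sqrt v)) * Real.exp (-(s ^ 2 / (4 * v))) := by
        gcongr
    _ = _ := by field_simp

/-- The pointwise Jensen-type inequality for the Poisson-Hermite semigroup. -/
lemma phLint_rpow_le {p : EuclideanSpace ℝ (Fin d) → ℝ} (hp : PGaussInf p)
    (hLH : LH0 p) : ∃ C : ℝ≥0, ∀ t : ℝ, 0 < t → ∀ φ : EuclideanSpace ℝ (Fin d) → ℝ≥0∞,
      Measurable φ → ∫⁻ y, φ y ^ p y ∂(gaussMeasure d) ≤ 1 →
      ∀ x, phLint t φ x ^ p x ≤ C * (1 + phLint t (fun y => φ y ^ p y) x) := by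
  obtain ⟨C, hC⟩ := ouLint_rpow_le hp hLH
  refine ⟨C, fun t ht φ hφ hmod x => ?_⟩
  calc phLint t φ x ^ p x
      ≤ ∫⁻ v, ENNReal.ofReal (subDens t v) * ouLint v φ x ^ p x :=
        rpow_lintegral_mul_le (measurable_ofReal_subDens t) (lintegral_subDens ht).le
          (hp.one_le x) (measurable_ouLint hφ x)
    _ ≤ ∫⁻ v, ENNReal.ofReal (subDens t v) * (C * (1 + ouLint v (fun y => φ y ^ p y) x)) :=
        lintegral_mono (subDens_mul_mono fun v hv => hC v hv φ hφ hmod x)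
    _ = C * (1 + phLint t (fun y => φ y ^ p y) x) := by
        simp_rw [mul_left_comm _ (C : ℝ≥0∞)]
        rw [lintegral_const_mul' _ _ ENNReal.coe_ne_top]
        simp_rw [mul_add, mul_one]
        rw [lintegral_add_left (measurable_ofReal_subDens t), lintegral_subDens ht, mul_add, mul_one]
        rfl

lemma lintegral_phLint_rpow_le {p : EuclideanSpace ℝ (Fin d) → ℝ} (hp : PGaussInf p)
    (hLH : LH0 p) : ∃ C : ℝ≥0, ∀ t : ℝ, 0 < t → ∀ φ : EuclideanSpace ℝ (Fin d) → ℝ≥0∞,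
      Measurable φ → ∫⁻ y, φ y ^ p y ∂(gaussMeasure d) ≤ 1 →
      ∫⁻ x, phLint t φ x ^ p x ∂(gaussMeasure d) ≤ C := by
  obtain ⟨C, hC⟩ := phLint_rpow_le hp hLH
  refine ⟨C * 2, fun t ht φ hφ hmod => ?_⟩
  -- The exponent is only almost everywhere measurable, so a measurable version is substituted
  -- before the invariance of $\gamma_d$ is used.
  have hae : (fun y => φ y ^ p y) =ᵐ[gaussMeasure d] fun y => φ y ^ hp.aemeasurable.mk p y :=
    hp.aemeasurable.ae_eq_mk.mono fun y hy => by simp only [hy]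
  calc ∫⁻ x, phLint t φ x ^ p x ∂(gaussMeasure d)
      ≤ ∫⁻ x, C * (1 + phLint t (fun y => φ y ^ p y) x) ∂(gaussMeasure d) :=
        lintegral_mono fun x => hC t ht φ hφ hmod x
    _ = C * (1 + ∫⁻ y, φ y ^ p y ∂(gaussMeasure d)) := by
        rw [lintegral_const_mul' _ _ ENNReal.coe_ne_top, lintegral_add_left measurable_const]
        simp_rw [phLint_congr_ae hae]
        rw [lintegral_phLint (hφ.pow hp.aemeasurable.measurable_mk) ht, lintegral_congr_ae hae]
        simp
    _ ≤ _ := by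
        rw [ENNReal.coe_mul, show ((2 : ℝ≥0) : ℝ≥0∞) = 1 + 1 by norm_num]
        gcongr

end Poisson

/-! ### Time derivatives of $P_tf$ for integrable $f$. -/

section Derivatives

variable {d : ℕ} {f : EuclideanSpace ℝ (Fin d) → ℝ}

lemma ouSemigroup_eq (s : ℝ) (f : EuclideanSpace ℝ (Fin d) → ℝ) (x : EuclideanSpace ℝ (Fin d)) :
    ouSemigroup s f x = ∫ y, mehlerKer s x y * f y ∂(gaussMeasure d) := by
  rw [ouSemigroup, ← integral_const_mul]
  simp_rw [mehlerKer, mul_assoc]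

lemma phDeriv_zero (t : ℝ) (f : EuclideanSpace ℝ (Fin d) → ℝ) :
    phDeriv 0 t f = phSemigroup t f := by
  funext x
  simp [phDeriv]

lemma phIntegrand_congr_ae {g : EuclideanSpace ℝ (Fin d) → ℝ} (h : f =ᵐ[gaussMeasure d] g)
    (t : ℝ) (x : EuclideanSpace ℝ (Fin d)) : phIntegrand t f x = phIntegrand t g x := by
  funext u
  rw [phIntegrand, phIntegrand, ouSemigroup_eq, ouSemigroup_eq]
  congr 1
  exact integral_congr_ae (h.mono fun y hy => by simp only [hy])

lemma phSemigroup_congr_ae {g : EuclideanSpace ℝ (Fin d) → ℝ} (h : f =ᵐ[gaussMeasure d] g)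
    (t : ℝ) (x : EuclideanSpace ℝ (Fin d)) : phSemigroup t f x = phSemigroup t g x := by
  simp_rw [phSemigroup, phIntegrand_congr_ae h]

lemma phDeriv_congr_ae {g : EuclideanSpace ℝ (Fin d) → ℝ} (h : f =ᵐ[gaussMeasure d] g)
    (k : ℕ) (t : ℝ) : phDeriv k t f = phDeriv k t g := by
  funext x
  simp_rw [phDeriv, phSemigroup_congr_ae h]

lemma enorm_ouSemigroup_le {s : ℝ} (hs : 0 < s) (x : EuclideanSpace ℝ (Fin d)) :
    ‖ouSemigroup s f x‖ₑ ≤ ouLint s (fun y => ‖f y‖ₑ) x := by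
  rw [ouSemigroup_eq]
  refine (enorm_integral_le_lintegral_enorm _).trans (le_of_eq ?_)
  refine lintegral_congr fun y => ?_
  rw [enorm_mul, Real.enorm_of_nonneg (mehlerKer_nonneg hs x y)]

lemma measurable_ouSemigroup (hf : Measurable f) (x : EuclideanSpace ℝ (Fin d)) :
    Measurable fun v => ouSemigroup v f x := by
  simp_rw [ouSemigroup_eq]
  exact (StronglyMeasurable.integral_prod_right'
    (f := fun q : ℝ × EuclideanSpace ℝ (Fin d) => mehlerKer q.1 x q.2 * f q.2)
    (by fun_prop : Measurable _).stronglyMeasurable).measurable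

lemma lintegral_enorm_subDens_mul_ouSemigroup_le {t : ℝ} (ht : 0 < t)
    (x : EuclideanSpace ℝ (Fin d)) :
    ∫⁻ v, ‖subDens t v * ouSemigroup v f x‖ₑ ≤ phLint t (fun y => ‖f y‖ₑ) x := by
  refine lintegral_mono fun v => ?_
  beta_reduce
  rw [enorm_mul, Real.enorm_of_nonneg (subDens_nonneg ht v)]
  exact subDens_mul_mono (a := fun v => ‖ouSemigroup v f x‖ₑ)
    (b := fun v => ouLint v (fun y => ‖f y‖ₑ) x) (fun v hv => enorm_ouSemigroup_le hv x) v

lemma integrable_subDens_mul_ouSemigroup (hf : Measurable f)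
    (hfi : Integrable f (gaussMeasure d)) (x : EuclideanSpace ℝ (Fin d)) {t : ℝ} (ht : 0 < t) :
    Integrable fun v => subDens t v * ouSemigroup v f x := by
  have := measurable_ouSemigroup hf x
  refine ⟨(by fun_prop : Measurable _).aestronglyMeasurable, ?_⟩
  exact (lintegral_enorm_subDens_mul_ouSemigroup_le ht x).trans_lt
    (phLint_lt_top ht hfi.2.ne x)

lemma phSemigroup_eq_integral_subDens {t : ℝ} (ht : 0 < t) (x : EuclideanSpace ℝ (Fin d)) :
    phSemigroup t f x = ∫ v, subDens t v * ouSemigroup v f x := by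
  have hpi : 0 < Real.sqrt Real.pi := Real.sqrt_pos.2 Real.pi_pos
  unfold phSemigroup phIntegrand
  rw [integral_exp_div_sqrt_mul ht (fun v => ouSemigroup v f x), ← mul_assoc,
    one_div_mul_cancel hpi.ne', one_mul]
  refine setIntegral_eq_integral_of_forall_compl_eq_zero fun v hv => ?_
  rw [subDens_of_nonpos t (not_lt.1 hv), zero_mul]

lemma phSemigroup_eventuallyEq {t : ℝ} (ht : 0 < t) (x : EuclideanSpace ℝ (Fin d)) :
    (fun t => phSemigroup t f x) =ᶠ[nhds t]
      fun t => ∫ v, subDens t v * ouSemigroup v f x :=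
  Filter.eventually_of_mem (Ioi_mem_nhds ht) fun _ hs => phSemigroup_eq_integral_subDens hs x

lemma integrableOn_phIntegrand (hf : Measurable f)
    (hfi : Integrable f (gaussMeasure d)) (x : EuclideanSpace ℝ (Fin d)) {t : ℝ} (ht : 0 < t) :
    IntegrableOn (phIntegrand t f x) (Ioi 0) :=
  (integrableOn_exp_div_sqrt_mul_iff ht (fun v => ouSemigroup v f x)).2
    (integrable_subDens_mul_ouSemigroup hf hfi x ht).integrableOn

lemma analyticAt_phSemigroup (hf : Measurable f)
    (hfi : Integrable f (gaussMeasure d)) (x : EuclideanSpace ℝ (Fin d)) {t : ℝ} (ht : 0 < t) :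
    AnalyticAt ℝ (fun t => phSemigroup t f x) t :=
  (analyticAt_integral_subDens (measurable_ouSemigroup hf x)
    (fun _ hs => integrable_subDens_mul_ouSemigroup hf hfi x hs) ht).congr
    (phSemigroup_eventuallyEq ht x).symm

lemma hasDerivAt_phDeriv (hf : Measurable f)
    (hfi : Integrable f (gaussMeasure d)) (x : EuclideanSpace ℝ (Fin d)) (k : ℕ) {t : ℝ}
    (ht : 0 < t) : HasDerivAt (fun t => phDeriv k t f x) (phDeriv (k + 1) t f x) t := by
  unfold phDeriv
  rw [iteratedDeriv_succ]
  have h : AnalyticAt ℝ (iteratedDeriv k fun t => phSemigroup t f x) t := by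
    rw [iteratedDeriv_eq_iterate]
    exact (analyticAt_phSemigroup hf hfi x ht).iterated_deriv k
  exact h.differentiableAt.hasDerivAt

/-- The Cauchy estimate applied to $v\mapsto T_vf(x)$. All the smoothing is in the subordination
density, so no derivative of the Mehler kernel is needed. -/
lemma enorm_phDeriv_le (hf : Measurable f)
    (hfi : Integrable f (gaussMeasure d)) (x : EuclideanSpace ℝ (Fin d)) (k : ℕ) {t : ℝ}
    (ht : 0 < t) : ‖phDeriv k t f x‖ₑ ≤
      ENNReal.ofReal (8 / 3 * (k.factorial * 4 ^ k / t ^ k)) *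
        phLint (t / 2) (fun y => ‖f y‖ₑ) x := by
  have hle := abs_iteratedDeriv_integral_subDens_le (measurable_ouSemigroup hf x)
    (fun _ hs => integrable_subDens_mul_ouSemigroup hf hfi x hs) k ht
  rw [← (phSemigroup_eventuallyEq ht x).iteratedDeriv_eq] at hle
  rw [Real.enorm_eq_ofReal_abs]
  refine (ENNReal.ofReal_le_ofReal hle).trans ?_
  rw [ENNReal.ofReal_mul (by positivity)]
  gcongr
  refine le_trans ?_ (lintegral_enorm_subDens_mul_ouSemigroup_le (half_pos ht) x)
  rw [ofReal_integral_eq_lintegral_ofReal]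
  · refine lintegral_mono fun v => le_of_eq ?_
    rw [Real.enorm_eq_ofReal_abs, abs_mul, abs_of_nonneg (subDens_nonneg (half_pos ht) v)]
  · have := (integrable_subDens_mul_ouSemigroup hf hfi x (half_pos ht)).abs
    simpa only [abs_mul, abs_of_nonneg (subDens_nonneg (half_pos ht) _)] using this
  · exact Filter.Eventually.of_forall fun v =>
      mul_nonneg (subDens_nonneg (half_pos ht) v) (abs_nonneg _)

lemma phSemigroup_eq_integral_phKer (hf : Measurable f)
    (hfi : Integrable f (gaussMeasure d)) (x : EuclideanSpace ℝ (Fin d)) {t : ℝ} (ht : 0 < t) :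
    phSemigroup t f x = ∫ y, (phKer t x y).toReal * f y ∂(gaussMeasure d) := by
  rw [phSemigroup_eq_integral_subDens ht]
  simp_rw [ouSemigroup_eq, ← integral_const_mul]
  rw [integral_integral_swap]
  · refine integral_congr_ae (Filter.Eventually.of_forall fun y => ?_)
    beta_reduce
    simp_rw [← mul_assoc]
    rw [integral_mul_const, integral_eq_lintegral_of_nonneg_ae]
    · congr 2
      refine lintegral_congr fun v => ?_
      exact ENNReal.ofReal_mul (subDens_nonneg ht v)
    · refine Filter.Eventually.of_forall fun v => ?_
      rcases le_or_gt v 0 with hv | hv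
      · simp [subDens_of_nonpos t hv]
      · exact mul_nonneg (subDens_nonneg ht v) (mehlerKer_nonneg hv x y)
    · exact (by fun_prop : Measurable _).aestronglyMeasurable
  · refine ⟨(by fun_prop : Measurable _).aestronglyMeasurable, ?_⟩
    rw [HasFiniteIntegral, lintegral_prod _ (by fun_prop)]
    refine lt_of_le_of_lt ?_ (phLint_lt_top ht hfi.2.ne x)
    refine lintegral_mono fun v => ?_
    rcases le_or_gt v 0 with hv | hv
    · simp [subDens_of_nonpos t hv]
    simp only [Function.uncurry, enorm_mul, Real.enorm_of_nonneg (subDens_nonneg ht v),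
      Real.enorm_of_nonneg (mehlerKer_nonneg hv x _)]
    rw [lintegral_const_mul' _ _ ENNReal.ofReal_ne_top]
    rfl

lemma enorm_phSemigroup_le {t : ℝ} (ht : 0 < t)
    (x : EuclideanSpace ℝ (Fin d)) :
    ‖phSemigroup t f x‖ₑ ≤ phLint t (fun y => ‖f y‖ₑ) x := by
  rw [phSemigroup_eq_integral_subDens ht]
  exact (enorm_integral_le_lintegral_enorm _).trans
    (lintegral_enorm_subDens_mul_ouSemigroup_le ht x)

lemma measurable_phSemigroup (hf : Measurable f)
    (hfi : Integrable f (gaussMeasure d)) {t : ℝ} (ht : 0 < t) :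
    Measurable (phSemigroup t f) := by
  have : phSemigroup t f = fun x => ∫ y, (phKer t x y).toReal * f y ∂(gaussMeasure d) :=
    funext fun x => phSemigroup_eq_integral_phKer hf hfi x ht
  rw [this]
  exact (StronglyMeasurable.integral_prod_right'
    (f := fun q : EuclideanSpace ℝ (Fin d) × EuclideanSpace ℝ (Fin d) =>
      (phKer t q.1 q.2).toReal * f q.2)
    (by fun_prop : Measurable _).stronglyMeasurable).measurable

/-- Each derivative is a pointwise limit of difference quotients of the previous one. -/
lemma measurable_phDeriv (hf : Measurable f)
    (hfi : Integrable f (gaussMeasure d)) (k : ℕ) :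
    ∀ {t : ℝ}, 0 < t → Measurable (phDeriv k t f) := by
  induction k with
  | zero =>
    intro t ht
    rw [phDeriv_zero]
    exact measurable_phSemigroup hf hfi ht
  | succ k ih =>
    intro t ht
    have hlim : Filter.Tendsto (fun n : ℕ => 1 / ((n : ℝ) + 1)) Filter.atTop (nhdsWithin 0 {0}ᶜ) :=
      tendsto_nhdsWithin_iff.2 ⟨tendsto_one_div_add_atTop_nhds_zero_nat,
        Filter.Eventually.of_forall fun n => by
          have : (0 : ℝ) < 1 / ((n : ℝ) + 1) := by positivity
          exact this.ne'⟩
    refine measurable_of_tendsto_metrizable (f := fun (n : ℕ) x =>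
      (1 / ((n : ℝ) + 1))⁻¹ • (phDeriv k (t + 1 / ((n : ℝ) + 1)) f x - phDeriv k t f x))
      (fun n => ?_) (tendsto_pi_nhds.2 fun x => ?_)
    · have h1 := ih ht
      have h2 := ih (t := t + 1 / ((n : ℝ) + 1)) (by positivity)
      fun_prop
    · exact (hasDerivAt_phDeriv hf hfi x k ht).tendsto_slope_zero.comp hlim

lemma integrable_phDeriv (hf : Measurable f)
    (hfi : Integrable f (gaussMeasure d)) (k : ℕ) {t : ℝ} (ht : 0 < t) :
    Integrable (phDeriv k t f) (gaussMeasure d) := by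
  refine ⟨(measurable_phDeriv hf hfi k ht).aestronglyMeasurable, ?_⟩
  refine lt_of_le_of_lt (lintegral_mono fun x => enorm_phDeriv_le hf hfi x k ht) ?_
  rw [lintegral_const_mul' _ _ ENNReal.ofReal_ne_top, lintegral_phLint (by fun_prop) (half_pos ht)]
  exact ENNReal.mul_lt_top ENNReal.ofReal_lt_top hfi.2

/-- Fubini reduces this to the semigroup law of the kernel; absolute convergence is the finiteness
of $P_{r+s}|f|(x)$. -/
lemma phSemigroup_phSemigroup (hf : Measurable f)
    (hfi : Integrable f (gaussMeasure d)) {r s : ℝ} (hr : 0 < r) (hs : 0 < s)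
    (x : EuclideanSpace ℝ (Fin d)) :
    phSemigroup r (phSemigroup s f) x = phSemigroup (s + r) f x := by
  have hm := measurable_phSemigroup hf hfi hs
  have hi : Integrable (phSemigroup s f) (gaussMeasure d) := by
    rw [← phDeriv_zero]
    exact integrable_phDeriv hf hfi 0 hs
  rw [phSemigroup_eq_integral_phKer hm hi x hr, phSemigroup_eq_integral_phKer hf hfi x (by positivity)]
  simp_rw [phSemigroup_eq_integral_phKer hf hfi _ hs, ← integral_const_mul]
  rw [integral_integral_swap]
  · refine integral_congr_ae (Filter.Eventually.of_forall fun y => ?_)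
    beta_reduce
    simp_rw [← mul_assoc]
    rw [integral_mul_const, add_comm s r, ← lintegral_phKer_mul_phKer hr hs x y,
      ← integral_toReal]
    · simp_rw [ENNReal.toReal_mul]
    · exact (by fun_prop : Measurable _).aemeasurable
    · exact Filter.Eventually.of_forall fun z =>
        ENNReal.mul_lt_top (phKer_lt_top hr x z) (phKer_lt_top hs z y)
  · refine ⟨(by fun_prop : Measurable _).aestronglyMeasurable, ?_⟩
    rw [HasFiniteIntegral, lintegral_prod _ (by fun_prop)]
    refine lt_of_le_of_lt (le_of_eq ?_)
      (phLint_lt_top (t := r + s) (by positivity) hfi.2.ne x)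
    rw [← phLint_phLint (by fun_prop) hr hs,
      phLint_eq_lintegral_phKer (measurable_phLint (by fun_prop) s)]
    refine lintegral_congr fun z => ?_
    simp only [Function.uncurry, enorm_mul, Real.enorm_of_nonneg ENNReal.toReal_nonneg,
      ENNReal.ofReal_toReal (phKer_lt_top hr x z).ne, ENNReal.ofReal_toReal (phKer_lt_top hs z _).ne]
    rw [lintegral_const_mul _ (by fun_prop), phLint_eq_lintegral_phKer (by fun_prop)]

/-- Time derivatives of the Poisson-Hermite semigroup commute with the semigroup. -/
lemma phSemigroup_phDeriv (hf : Measurable f)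
    (hfi : Integrable f (gaussMeasure d)) {r : ℝ} (hr : 0 < r) (x : EuclideanSpace ℝ (Fin d))
    (k : ℕ) : ∀ {s : ℝ}, 0 < s →
      phSemigroup r (phDeriv k s f) x = phDeriv k (s + r) f x := by
  induction k with
  | zero =>
    intro s hs
    rw [phDeriv_zero, phDeriv_zero]
    exact phSemigroup_phSemigroup hf hfi hr hs x
  | succ k ih =>
    intro s hs
    have hm : ∀ k {s : ℝ}, 0 < s → Measurable (phDeriv k s f) := fun k _ hs =>
      measurable_phDeriv hf hfi k hs
    have hφ : Measurable fun y => ‖f y‖ₑ := by fun_prop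
    have hΨ := measurable_phLint hφ (s / 4)
    have htop := fun y => phLint_lt_top (t := s / 4) (by positivity) hfi.2.ne y
    set Ψ := phLint (s / 4) (fun y => ‖f y‖ₑ) with hΨdef
    -- For $|\sigma-s|<s/2$ one has $\sigma>s/2$ and $(\sigma/2)/(s/4)<3$, so the derivative at
    -- $\sigma$ is at most $c\,P_{s/4}|f|$, uniformly in $\sigma$.
    set c : ℝ := 8 / 3 * ((k + 1).factorial * 4 ^ (k + 1) / (s / 2) ^ (k + 1)) * 3 with hc
    have hc0 : 0 ≤ c := by positivity
    have hbound : ∀ σ ∈ Metric.ball s (s / 2), ∀ y,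
        ‖phDeriv (k + 1) σ f y‖ ≤ c * (Ψ y).toReal := by
      intro σ hσ y
      rw [Real.ball_eq_Ioo] at hσ
      have hσ1 : s / 2 < σ := by linarith [hσ.1]
      have hσ0 : 0 < σ := by linarith
      rw [← ENNReal.toReal_ofReal hc0, ← ENNReal.toReal_mul, ← toReal_enorm]
      refine ENNReal.toReal_mono (ENNReal.mul_lt_top ENNReal.ofReal_lt_top (htop y)).ne ?_
      refine (enorm_phDeriv_le hf hfi y (k + 1) hσ0).trans ?_
      rw [hc, ENNReal.ofReal_mul
        (p := 8 / 3 * ((k + 1).factorial * 4 ^ (k + 1) / (s / 2) ^ (k + 1))) (by positivity),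
        mul_assoc]
      refine mul_le_mul' (ENNReal.ofReal_le_ofReal (by gcongr)) ?_
      refine (phLint_le_of_le (s := s / 4) (t := σ / 2) (by positivity) (by linarith) _ y).trans ?_
      gcongr
      rw [div_le_iff₀ (by positivity)]
      linarith [hσ.2]
    have hmain := (hasDerivAt_integral_of_dominated_loc_of_deriv_le (μ := gaussMeasure d)
      (F := fun σ y => (phKer r x y).toReal * phDeriv k σ f y)
      (F' := fun σ y => (phKer r x y).toReal * phDeriv (k + 1) σ f y)
      (bound := fun y => (phKer r x y).toReal * (c * (Ψ y).toReal))
      (Metric.ball_mem_nhds s (half_pos hs)) ?_ ?_ ?_ ?_ ?_ ?_).2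
    -- By the induction hypothesis the integral at time $\sigma$ is the $k$-th derivative at
    -- $\sigma+r$; both sides are its derivative at $\sigma=s$.
    · rw [phSemigroup_eq_integral_phKer (hm _ hs) (integrable_phDeriv hf hfi _ hs) x hr]
      refine HasDerivAt.unique hmain ?_
      have h1 : HasDerivAt (fun σ => phDeriv k (σ + r) f x) (phDeriv (k + 1) (s + r) f x) s :=
        (hasDerivAt_phDeriv hf hfi x k (by positivity : 0 < s + r)).comp_add_const s r
      refine h1.congr_of_eventuallyEq ?_
      refine Filter.eventually_of_mem (Ioi_mem_nhds hs) fun σ hσ => ?_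
      have hσ0 : 0 < σ := hσ
      beta_reduce
      rw [← ih hσ0, phSemigroup_eq_integral_phKer (hm _ hσ0) (integrable_phDeriv hf hfi _ hσ0) x hr]
    · refine Filter.eventually_of_mem (Ioi_mem_nhds hs) fun σ hσ => ?_
      have := hm k (show 0 < σ from hσ)
      exact (by fun_prop : Measurable _).aestronglyMeasurable
    · have := hm k hs
      refine ⟨(by fun_prop : Measurable _).aestronglyMeasurable, ?_⟩
      refine lt_of_le_of_lt (le_of_eq ?_) (phLint_lt_top hr (integrable_phDeriv hf hfi k hs).2.ne x)
      rw [phLint_eq_lintegral_phKer (by fun_prop)]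
      refine lintegral_congr fun y => ?_
      rw [enorm_mul, Real.enorm_of_nonneg ENNReal.toReal_nonneg,
        ENNReal.ofReal_toReal (phKer_lt_top hr x y).ne]
    · have := hm (k + 1) hs
      exact (by fun_prop : Measurable _).aestronglyMeasurable
    · refine Filter.Eventually.of_forall fun y σ hσ => ?_
      rw [norm_mul, Real.norm_of_nonneg ENNReal.toReal_nonneg]
      gcongr
      exact hbound σ hσ y
    · simp_rw [mul_left_comm _ c]
      refine Integrable.const_mul ?_ c
      refine ⟨(by fun_prop : Measurable _).aestronglyMeasurable, ?_⟩
      refine lt_of_le_of_lt (le_of_eq ?_)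
        (phLint_lt_top (t := r + s / 4) (by positivity) hfi.2.ne x)
      rw [← phLint_phLint hφ hr (by positivity), phLint_eq_lintegral_phKer hΨ]
      refine lintegral_congr fun y => ?_
      rw [enorm_mul, Real.enorm_of_nonneg ENNReal.toReal_nonneg,
        Real.enorm_of_nonneg ENNReal.toReal_nonneg,
        ENNReal.ofReal_toReal (phKer_lt_top hr x y).ne, ENNReal.ofReal_toReal (htop y).ne]
    · refine Filter.Eventually.of_forall fun y σ hσ => ?_
      rw [Real.ball_eq_Ioo] at hσ
      exact (hasDerivAt_phDeriv hf hfi y k (by linarith [hσ.1])).const_mul _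

end Derivatives

/-! ### From modular bounds to Luxemburg norms. -/

section VariableLebesgue

variable {d : ℕ} {p f g h : EuclideanSpace ℝ (Fin d) → ℝ}

lemma modular_eq_lintegral_enorm (hp : ∀ x, 1 ≤ p x) (f : EuclideanSpace ℝ (Fin d) → ℝ) :
    modular p f = ∫⁻ x, ‖f x‖ₑ ^ p x ∂(gaussMeasure d) := by
  refine lintegral_congr fun x => ?_
  rw [Real.enorm_eq_ofReal_abs,
    ENNReal.ofReal_rpow_of_nonneg (abs_nonneg _) (by linarith [hp x])]

lemma modular_congr_ae (h : f =ᵐ[gaussMeasure d] g) (l : ℝ) :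
    modular p (fun x => f x / l) = modular p (fun x => g x / l) :=
  lintegral_congr_ae (h.mono fun x hx => by simp only [hx])

lemma varNorm_congr_ae (h : f =ᵐ[gaussMeasure d] g) : varNorm p f = varNorm p g := by
  simp_rw [varNorm, modular_congr_ae h]

/-- From $z\le1+z^{p}$ and the finiteness of $\gamma_d$; it brings all of $L^{p(\cdot)}(\gamma_d)$
within reach of the $L^1$ theory. -/
lemma MemVarLp.integrable (hp : ∀ x, 1 ≤ p x) (hf : MemVarLp p f) :
    Integrable f (gaussMeasure d) := by
  obtain ⟨hm, l, hl, hlt⟩ := hf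
  have hi : Integrable (fun x => f x / l) (gaussMeasure d) := by
    refine ⟨(hm.div_const l).aestronglyMeasurable, ?_⟩
    rw [modular_eq_lintegral_enorm hp] at hlt
    have hle : ∀ x, ‖f x / l‖ₑ ≤ 1 + ‖f x / l‖ₑ ^ p x := fun x => by
      rcases le_total ‖f x / l‖ₑ 1 with h1 | h1
      · exact h1.trans le_self_add
      · calc ‖f x / l‖ₑ = ‖f x / l‖ₑ ^ (1 : ℝ) := (ENNReal.rpow_one _).symm
          _ ≤ ‖f x / l‖ₑ ^ p x := ENNReal.rpow_le_rpow_of_exponent_le h1 (hp x)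
          _ ≤ _ := le_add_self
    refine (lintegral_mono hle).trans_lt ?_
    rw [lintegral_add_left measurable_const]
    simpa using hlt
  have := hi.mul_const l
  simpa [div_mul_cancel₀ _ hl.ne'] using this

/-- Because $p\ge1$ and $c\ge1$, $c^{-p(x)}\le c^{-1}$. A modular bounded by a constant is thereby
brought below one by rescaling. -/
lemma modular_div_mul_le (hp : ∀ x, 1 ≤ p x) {l c : ℝ} (hc : 1 ≤ c) :
    modular p (fun x => f x / (l * c)) ≤
      ENNReal.ofReal c⁻¹ * modular p (fun x => f x / l) := by
  rw [modular_eq_lintegral_enorm hp, modular_eq_lintegral_enorm hp,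
    ← lintegral_const_mul' _ _ ENNReal.ofReal_ne_top]
  refine lintegral_mono fun x => ?_
  have hc1 : ENNReal.ofReal c⁻¹ ≤ 1 := by
    rw [ENNReal.ofReal_le_one]; exact inv_le_one_of_one_le₀ hc
  have : f x / (l * c) = c⁻¹ * (f x / l) := by
    rw [← div_div, div_eq_inv_mul _ c]
  beta_reduce
  rw [this, enorm_mul, Real.enorm_of_nonneg (by positivity),
    ENNReal.mul_rpow_of_nonneg _ _ (by linarith [hp x])]
  gcongr
  calc ENNReal.ofReal c⁻¹ ^ p x ≤ ENNReal.ofReal c⁻¹ ^ (1 : ℝ) :=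
        ENNReal.rpow_le_rpow_of_exponent_ge hc1 (hp x)
    _ = _ := ENNReal.rpow_one _

lemma MemVarLp.exists_modular_le_one (hp : ∀ x, 1 ≤ p x) (hf : MemVarLp p f) :
    ∃ l : ℝ, 0 < l ∧ modular p (fun x => f x / l) ≤ 1 := by
  obtain ⟨-, l, hl, hlt⟩ := hf
  set M := (modular p (fun x => f x / l)).toReal with hM
  have hM0 : 0 ≤ M := ENNReal.toReal_nonneg
  refine ⟨l * (M + 1), by positivity, (modular_div_mul_le hp (by linarith)).trans ?_⟩
  rw [← ENNReal.ofReal_toReal hlt.ne, ← hM, ← ENNReal.ofReal_mul (by positivity),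
    ENNReal.ofReal_le_one, inv_mul_le_one₀ (by positivity)]
  linarith

/-- Functions dominated by the Poisson-Hermite semigroup inherit modular bounds. -/
lemma modular_le_one_of_enorm_le_phLint (hp : PGaussInf p) (hLH : LH0 p) :
    ∃ D : ℝ, 1 ≤ D ∧ ∀ (g h : EuclideanSpace ℝ (Fin d) → ℝ) (t c l : ℝ), 0 < t → 0 < c → 0 < l →
      Measurable g → (∀ x, ‖h x‖ₑ ≤ ENNReal.ofReal c * phLint t (fun y => ‖g y‖ₑ) x) →
      modular p (fun x => g x / l) ≤ 1 → modular p (fun x => h x / (c * D * l)) ≤ 1 := by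
  obtain ⟨C, hC⟩ := lintegral_phLint_rpow_le hp hLH
  refine ⟨C + 1, by simp, fun g h t c l ht hc hl hg hle hmod => ?_⟩
  have hp1 := hp.one_le
  set D : ℝ := C + 1 with hD
  have hD1 : 1 ≤ D := by simp [hD]
  rw [modular_eq_lintegral_enorm hp1] at hmod
  have hassoc : (fun x => h x / (c * D * l)) = fun x => h x / (c * l * D) := by
    funext x; congr 1; ring
  rw [hassoc]
  refine (modular_div_mul_le hp1 hD1).trans ?_
  have hbound : modular p (fun x => h x / (c * l)) ≤ C := by
    rw [modular_eq_lintegral_enorm hp1]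
    refine le_trans (lintegral_mono fun x => ?_) (hC t ht (fun y => ‖g y / l‖ₑ) (by fun_prop) hmod)
    refine ENNReal.rpow_le_rpow ?_ (by linarith [hp1 x])
    have hscale : phLint t (fun y => ‖g y / l‖ₑ) x =
        ENNReal.ofReal l⁻¹ * phLint t (fun y => ‖g y‖ₑ) x := by
      rw [phLint_eq_lintegral_phKer (by fun_prop), phLint_eq_lintegral_phKer (by fun_prop),
        ← lintegral_const_mul' _ _ ENNReal.ofReal_ne_top]
      refine lintegral_congr fun y => ?_
      rw [div_eq_inv_mul, enorm_mul, Real.enorm_of_nonneg (by positivity), mul_left_comm]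
    rw [hscale, div_eq_inv_mul, enorm_mul, Real.enorm_of_nonneg (by positivity)]
    refine (mul_le_mul_right (hle x) _).trans (le_of_eq ?_)
    rw [← mul_assoc, ← ENNReal.ofReal_mul (by positivity)]
    congr 2
    field_simp
  calc ENNReal.ofReal D⁻¹ * modular p (fun x => h x / (c * l)) ≤ ENNReal.ofReal D⁻¹ * C := by
        gcongr
    _ ≤ 1 := by
        rw [← ENNReal.ofReal_coe_nnreal, ← ENNReal.ofReal_mul (by positivity),
          ENNReal.ofReal_le_one, inv_mul_le_one₀ (by positivity)]
        simp [hD]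

lemma varNorm_le_of_modular_le {K : ℝ} (hK : 0 < K)
    (H : ∀ l : ℝ, 0 < l → modular p (fun x => g x / l) ≤ 1 →
      modular p (fun x => h x / (K * l)) ≤ 1) :
    varNorm p h ≤ ENNReal.ofReal K * varNorm p g := by
  have hK0 : ENNReal.ofReal K ≠ 0 := by simpa using hK
  unfold varNorm
  simp_rw [ENNReal.mul_iInf_of_ne hK0 ENNReal.ofReal_ne_top]
  refine le_iInf₂ fun l hl => ?_
  rw [← ENNReal.ofReal_mul hK.le]
  exact iInf₂_le (K * l) ⟨mul_pos hK hl.1, H l hl.1 hl.2⟩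

lemma integrable_mehlerExp_mul (hfi : Integrable f (gaussMeasure d)) {s : ℝ} (hs : 0 < s)
    (x : EuclideanSpace ℝ (Fin d)) :
    Integrable (fun y => mehlerExp s x y * f y) (gaussMeasure d) := by
  have hm : Measurable fun y => mehlerExp s x y := by unfold mehlerExp; fun_prop
  have hpos := one_sub_exp_pos hs
  refine hfi.bdd_mul (c := Real.exp (‖x‖ ^ 2)) hm.aestronglyMeasurable
    (Filter.Eventually.of_forall fun y => ?_)
  rw [Real.norm_of_nonneg (show 0 ≤ mehlerExp s x y from Real.exp_nonneg _)]
  exact le_of_mul_le_mul_left (mehlerKer_le hs x y) (by positivity)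

end VariableLebesgue

end VarGauss

end

/-! ### The two estimates. -/

theorem mainTheorem7 (d : ℕ) (p : EuclideanSpace ℝ (Fin d) → ℝ)
    (hp : VarGauss.PGaussInf p) (hLH : VarGauss.LH0 p) :
    -- all objects in the two estimates are well defined
    (∀ f, VarGauss.MemVarLp p f →
      (∀ x,
        (∀ s : ℝ, 0 < s →
          Integrable (fun y => VarGauss.mehlerExp s x y * f y) (VarGauss.gaussMeasure d)) ∧
        (∀ t : ℝ, 0 < t → IntegrableOn (VarGauss.phIntegrand t f x) (Ioi 0)) ∧
        ContDiffOn ℝ ∞ (fun t => VarGauss.phSemigroup t f x) (Ioi 0)) ∧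
      (∀ (k : ℕ) (t : ℝ), 0 < t → VarGauss.MemVarLp p (VarGauss.phDeriv k t f))) ∧
    -- quasi-monotonicity in time
    (∃ C : ℝ≥0, ∀ (k : ℕ) (f : EuclideanSpace ℝ (Fin d) → ℝ), VarGauss.MemVarLp p f →
      ∀ s t : ℝ, 0 < s → s < t →
        VarGauss.varNorm p (VarGauss.phDeriv k t f) ≤
          C * VarGauss.varNorm p (VarGauss.phDeriv k s f)) ∧
    -- decay
    (∀ k : ℕ, ∃ C : ℝ≥0, ∀ f : EuclideanSpace ℝ (Fin d) → ℝ, VarGauss.MemVarLp p f →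
      ∀ t : ℝ, 0 < t →
        VarGauss.varNorm p (VarGauss.phDeriv k t f) ≤
          ENNReal.ofReal (C / t ^ k) * VarGauss.varNorm p f) := by
  open VarGauss in
  have hp1 := hp.one_le
  obtain ⟨D, hD1, hD⟩ := modular_le_one_of_enorm_le_phLint hp hLH
  have hD0 : 0 < D := by linarith
  have hmk : ∀ f, MemVarLp p f → ∃ g : EuclideanSpace ℝ (Fin d) → ℝ, Measurable g ∧
      f =ᵐ[gaussMeasure d] g ∧ Integrable g (gaussMeasure d) := fun f hf =>
    ⟨hf.1.mk f, hf.1.measurable_mk, hf.1.ae_eq_mk, (hf.integrable hp1).congr hf.1.ae_eq_mk⟩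
  refine ⟨fun f hf => ?_, ⟨D.toNNReal, fun k f hf s t hs hst => ?_⟩, fun k =>
    ⟨(8 / 3 * (k.factorial * 4 ^ k) * D).toNNReal, fun f hf t ht => ?_⟩⟩
  · obtain ⟨g, hgm, hfg, hgi⟩ := hmk f hf
    refine ⟨fun x => ⟨fun s hs => integrable_mehlerExp_mul (hf.integrable hp1) hs x,
      fun t ht => ?_, ?_⟩, fun k t ht => ?_⟩
    · rw [phIntegrand_congr_ae hfg]
      exact integrableOn_phIntegrand hgm hgi x ht
    · simp_rw [phSemigroup_congr_ae hfg]
      exact fun t ht => (analyticAt_phSemigroup hgm hgi x ht).contDiffAt.contDiffWithinAt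
    · rw [phDeriv_congr_ae hfg]
      obtain ⟨l, hl, hl1⟩ := hf.exists_modular_le_one hp1
      rw [modular_congr_ae hfg] at hl1
      refine ⟨(measurable_phDeriv hgm hgi k ht).aemeasurable,
        8 / 3 * (k.factorial * 4 ^ k / t ^ k) * D * l, by positivity, ?_⟩
      exact (hD g _ (t / 2) _ l (half_pos ht) (by positivity) hl hgm
        (fun x => enorm_phDeriv_le hgm hgi x k ht) hl1).trans_lt ENNReal.one_lt_top
  · obtain ⟨g, hgm, hfg, hgi⟩ := hmk f hf
    rw [phDeriv_congr_ae hfg, phDeriv_congr_ae hfg]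
    refine varNorm_le_of_modular_le hD0 fun l hl hl1 => ?_
    have hts : 0 < t - s := by linarith
    -- The derivative at $t$ is $P_{t-s}$ of the derivative at $s$, so the factor is 1 and `D` alone
    -- remains, for every $k$.
    have := hD (phDeriv k s g) (phDeriv k t g) (t - s) 1 l hts one_pos hl
      (measurable_phDeriv hgm hgi k hs) (fun x => ?_) hl1
    · simpa using this
    · have h1 := phSemigroup_phDeriv hgm hgi hts x k hs
      rw [add_sub_cancel] at h1
      rw [← h1, ENNReal.ofReal_one, one_mul]
      exact enorm_phSemigroup_le hts x
  · obtain ⟨g, hgm, hfg, hgi⟩ := hmk f hf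
    rw [phDeriv_congr_ae hfg, varNorm_congr_ae hfg, Real.coe_toNNReal _ (by positivity)]
    refine varNorm_le_of_modular_le (by positivity) fun l hl hl1 => ?_
    -- The derivative is dominated by $P_{t/2}|g|$ with the Cauchy factor, which carries the power
    -- $t^{-k}$.
    have := hD g (phDeriv k t g) (t / 2) (8 / 3 * (k.factorial * 4 ^ k / t ^ k)) l (half_pos ht)
      (by positivity) hl hgm (fun x => enorm_phDeriv_le hgm hgi x k ht) hl1
    convert! this using 4
    ring
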